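/- **Conventions.** Let $L$ be a countable first-order language and $L^*=L\cup\{R_1,\dots,R_n\}$, where the $R_i$ are finitely many relation symbols not in $L$. All structures are nonempty; $\mathbf A\le\mathbf B$ means that $\mathbf A$ embeds into $\mathbf B$, and $\mathbf A^*|_L$ denotes the $L$-reduct of an $L^*$-structure $\mathbf A^*$. A *Fraïssé class* is an isomorphism-closed class of finite structures with countably many isomorphism types and members of arbitrarily large finite cardinality, which has the hereditary, joint embedding and amalgamation properties. Its *Fraïssé limit* is the (unique up to isomorphism) countably infinite, locally finite, ultrahomogeneous structure whose finite substructures are, up to isomorphism, exactly the members of the class. Let $\mathcal K$ and $\mathcal K^*$ be Fraïssé classes in $L$ and $L^*$ with $\{\mathbf A^*|_L:\mathbf A^*\in\mathcal K^*\}=\mathcal K$. The pair $(\mathcal K,\mathcal K^*)$ is *excellent* if the following hold. - (Reasonable) For all $\mathbf A^*\in\mathcal K^*$, $\mathbf B\in\mathcal K$ and every embedding $f:\mathbf A^*|_L\to\mathbf B$ there is $\mathbf B^*\in\mathcal K^*$ with $\mathbf B^*|_L=\mathbf B$ such that $f:\mathbf A^*\to\mathbf B^*$ is an embedding. - (Expansion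 property) For each $\mathbf A\in\mathcal K$ there is $\mathbf B\in\mathcal K$ such that $\mathbf A^*\le\mathbf B^*$ for all $\mathbf A^*,\mathbf B^*\in\mathcal K^*$ with $\mathbf A^*|_L=\mathbf A$ and $\mathbf B^*|_L=\mathbf B$. - (Ramsey property of $\mathcal K^*$) For all $\mathbf A\le\mathbf B$ in $\mathcal K^*$ and $k\ge2$ there is $\mathbf C\in\mathcal K^*$ with $\mathbf B\le\mathbf C$ such that for every coloring with $k$ colors of the substructures of $\mathbf C$ isomorphic to $\mathbf A$, there is a substructure $\mathbf B_0\cong\mathbf B$ of $\mathbf C$ such that all substructures of $\mathbf B_0$ isomorphic to $\mathbf A$ have the same color. - (Rigidity of $\mathcal K^*$) No structure in $\mathcal K^*$ has a nontrivial automorphism. A topological group $G$ is *amenable* if every jointly continuous action of $G$ on a nonempty compact Hausdorff space has an invariant Borel probability measure. Let $(\mathcal K,\mathcal K^*)$ be an excellent pair and $\mathbf K$ the Fraïssé limit of $\mathcal K$; give $\mathrm{Aut}(\mathbf K)$ the topology of pointwise convergence, $\mathbf K$ being discrete. Let $\mathrm{Fin}(\mathbf K)$ be the set of finite substructures of $\mathbf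 K$. For $\mathbf A\in\mathrm{Fin}(\mathbf K)$ let $\mathcal K^*(\mathbf A)$ be the set of expansions $\langle\mathbf A,S_1,\dots,S_n\rangle$ of $\mathbf A$ that belong to $\mathcal K^*$. For $x\in\mathcal K^*(\mathbf A)$, $\mathbf B\in\mathrm{Fin}(\mathbf K)$ and an embedding $\pi:\mathbf A\to\mathbf B$ let $\mathcal K^*(x,\mathbf B,\pi)$ be the (finite) set of those $y\in\mathcal K^*(\mathbf B)$ for which $\pi:x\to y$ is an embedding. Let $\Omega=\bigcup_{\mathbf A\in\mathrm{Fin}(\mathbf K)}\mathcal K^*(\mathbf A)$, let $\mathbb Q\Omega$ be the vector space over $\mathbb Q$ with basis $\Omega$, and let $V\subseteq\mathbb Q\Omega$ be the subspace spanned by all elements $$x-\sum_{y\in\mathcal K^*(x,\mathbf B,\pi)}y\qquad(\mathbf A,\mathbf B\in\mathrm{Fin}(\mathbf K),\ x\in\mathcal K^*(\mathbf A),\ \pi:\mathbf A\to\mathbf B\text{ an embedding}).$$ **Theorem 3.1.** $\mathrm{Aut}(\mathbf K)$ is amenable if and only if for every nonzero $v=\sum_{x\in\Omega}c_x x$ in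 $V$ there are $x,y\in\Omega$ with $c_x>0$ and $c_y<0$. -/

import Mathlib

open FirstOrder FirstOrder.Language CategoryTheory MeasureTheory

universe u v u' v' w

noncomputable section

namespace CompanionClass

/-! ### The automorphism group and amenability -/

section Amenability

/-- The automorphism group of an `L`-structure. -/
def Aut (L : FirstOrder.Language.{u, v}) (M : Type w) [L.Structure M] : Type w := M ≃[L] M

variable (L : FirstOrder.Language.{u, v}) (M : Type w) [L.Structure M]

instance : Group (Aut L M) where
  mul g h := FirstOrder.Language.Equiv.comp g h
  one := FirstOrder.Language.Equiv.refl L M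
  inv g := FirstOrder.Language.Equiv.symm g
  mul_assoc _ _ _ := rfl
  one_mul _ := rfl
  mul_one _ := rfl
  inv_mul_cancel g := FirstOrder.Language.Equiv.symm_comp_self g

/-- The action of an automorphism on the universe of the structure. -/
def Aut.toFun {L : FirstOrder.Language.{u, v}} {M : Type w} [L.Structure M] (g : Aut L M) :
    M → M :=
  fun a => (show M ≃[L] M from g) a

/-- The pointwise convergence topology: the coarsest topology for which each evaluation map
`g ↦ g a` into the discrete space `M` is continuous. -/
instance : TopologicalSpace (Aut L M) :=
  ⨅ a : M, TopologicalSpace.induced (fun g : Aut L M => g.toFun a) ⊥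

/-- A topological group is amenable if every jointly continuous action of it on a nonempty compact
Hausdorff space has an invariant Borel probability measure. -/
def IsAmenable (G : Type w) [Group G] [TopologicalSpace G] : Prop :=
  ∀ (X : Type w) [TopologicalSpace X] [CompactSpace X] [T2Space X] [Nonempty X]
    [MeasurableSpace X] [BorelSpace X] [MulAction G X] [ContinuousSMul G X],
    ∃ μ : Measure X, IsProbabilityMeasure μ ∧ SMulInvariantMeasure G X μ

end Amenability

/-! ### Fraïssé classes and their limits -/

section Fraisse

variable {L : FirstOrder.Language.{u, v}}

/-- A Fraïssé class of finite (nonempty) structures. -/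
structure IsFraisseClass (K : Set (Bundled.{w} L.Structure)) : Prop where
  finite : ∀ A ∈ K, Finite A
  nonempty : ∀ A ∈ K, Nonempty A
  isomorphism_closed : ∀ A B : Bundled.{w} L.Structure, A ∈ K → Nonempty (A ≃[L] B) → B ∈ K
  countably_many_types : (Quotient.mk (equivSetoid (L := L)) '' K).Countable
  arbitrarily_large : ∀ n : ℕ, ∃ A ∈ K, n ≤ Nat.card A
  hereditary : ∀ A B : Bundled.{w} L.Structure, B ∈ K → Nonempty A → Nonempty (A ↪[L] B) → A ∈ K
  jointEmbedding : JointEmbedding K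
  amalgamation : Amalgamation K

/-- `M` is a Fraïssé limit of `K`: it is a countably infinite, locally finite, ultrahomogeneous
structure, and `K` consists of the finite (nonempty) structures that embed into it. -/
structure IsLimit (K : Set (Bundled.{w} L.Structure)) (M : Type w) [L.Structure M] : Prop where
  countable : Countable M
  infinite : Infinite M
  locally_finite : ∀ S : L.Substructure M, S.FG → Finite S
  ultrahomogeneous : L.IsUltrahomogeneous M
  age_eq : {A : Bundled.{w} L.Structure | Finite A ∧ Nonempty A ∧ Nonempty (A ↪[L] M)} = K

/-- The substructures of `C` which are isomorphic to `A`. -/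
def Copies (C A : Bundled.{w} L.Structure) : Set (L.Substructure C) :=
  {S | Nonempty (S ≃[L] A)}

/-- The Ramsey property, for colorings of substructures. The copies of `A` inside a substructure
`B₀` of `C` are the copies of `A` in `C` that are contained in `B₀`. -/
def RamseyProperty (K : Set (Bundled.{w} L.Structure)) : Prop :=
  ∀ A ∈ K, ∀ B ∈ K, Nonempty (A ↪[L] B) → ∀ k : ℕ, 2 ≤ k →
    ∃ C ∈ K, Nonempty (B ↪[L] C) ∧
      ∀ c : Copies C A → Fin k, ∃ B₀ ∈ Copies C B,
        ∀ S T : Copies C A, S.1 ≤ B₀ → T.1 ≤ B₀ → c S = c T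

/-- Every structure in `K` is rigid, i.e. has no nontrivial automorphism. -/
def ConsistsOfRigid (K : Set (Bundled.{w} L.Structure)) : Prop :=
  ∀ A ∈ K, ∀ g : A ≃[L] A, ∀ a : A, g a = a

end Fraisse

/-! ### Expansions and excellent pairs

The larger language is `L.sum L'`, the union of `L` with a disjoint language `L'` that has finitely
many relation symbols and no function symbols. An expansion of an `L`-structure to `L.sum L'` is
the same as an `L'`-structure on its universe. -/

section Pairs

variable {L : FirstOrder.Language.{u, v}} {L' : FirstOrder.Language.{u', v'}}

/-- The reduct of an `L.sum L'`-structure to `L`. -/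
def reduct (A : Bundled.{w} (L.sum L').Structure) : Bundled.{w} L.Structure :=
  ⟨A, (LHom.sumInl : L →ᴸ L.sum L').reduct A⟩

/-- The expansion `⟨A, E⟩` of an `L`-structure on `A` by an `L'`-structure `E` on `A`. -/
def expand (A : Type w) [L.Structure A] (E : L'.Structure A) :
    Bundled.{w} (L.sum L').Structure :=
  ⟨A, @FirstOrder.Language.sumStructure L L' A _ E⟩

/-- The embedding `f` of `L`-structures is an embedding of the expansion `⟨A, E⟩` into the expansion
`⟨B, F⟩`, i.e. it also preserves and reflects the relations of `L'`. -/
def IsExpansionEmbedding {A B : Type w} [L.Structure A] [L.Structure B]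
    (E : L'.Structure A) (F : L'.Structure B) (f : A ↪[L] B) : Prop :=
  ∀ (n : ℕ) (R : L'.Relations n) (a : Fin n → A), F.RelMap R (f ∘ a) ↔ E.RelMap R a

/-- Reasonable pairs. -/
def IsReasonable (K : Set (Bundled.{w} L.Structure))
    (Kstar : Set (Bundled.{w} (L.sum L').Structure)) : Prop :=
  ∀ (A B : Bundled.{w} L.Structure) (E : L'.Structure A) (f : A ↪[L] B),
    expand A E ∈ Kstar → B ∈ K →
      ∃ F : L'.Structure B, expand B F ∈ Kstar ∧ IsExpansionEmbedding E F f

/-- The expansion property. -/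
def ExpansionProperty (K : Set (Bundled.{w} L.Structure))
    (Kstar : Set (Bundled.{w} (L.sum L').Structure)) : Prop :=
  ∀ A ∈ K, ∃ B ∈ K, ∀ Astar ∈ Kstar, ∀ Bstar ∈ Kstar,
    reduct Astar = A → reduct Bstar = B → Nonempty (Astar ↪[L.sum L'] Bstar)

/-- Excellent pairs of Fraïssé classes. -/
structure IsExcellentPair (K : Set (Bundled.{w} L.Structure))
    (Kstar : Set (Bundled.{w} (L.sum L').Structure)) : Prop where
  fraisse : IsFraisseClass K
  fraisse_star : IsFraisseClass Kstar
  reduct_image : reduct '' Kstar = K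
  reasonable : IsReasonable K Kstar
  expansion : ExpansionProperty K Kstar
  ramsey : RamseyProperty Kstar
  rigid : ConsistsOfRigid Kstar

end Pairs

/-! ### The vector space -/

section VectorSpace

variable {L : FirstOrder.Language.{u, v}} {L' : FirstOrder.Language.{u', v'}}

/-- The set of finite (nonempty) substructures of `M`. -/
def FinSub (L : FirstOrder.Language.{u, v}) (M : Type w) [L.Structure M] : Type w :=
  {A : L.Substructure M // Finite A ∧ Nonempty A}

/-- The expansions in `Kstar` of a structure `A`, given as `L'`-structures on `A`. -/
def Expansions (Kstar : Set (Bundled.{w} (L.sum L').Structure)) (A : Type w) [L.Structure A] :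
    Set (L'.Structure A) :=
  {E | expand A E ∈ Kstar}

/-- The set `Ω`, the disjoint union over the finite substructures `A` of `M` of the sets of
expansions of `A` in `Kstar`. -/
def Omega (Kstar : Set (Bundled.{w} (L.sum L').Structure)) (M : Type w) [L.Structure M] :
    Type (max u' v' w) :=
  Σ A : FinSub L M, Expansions Kstar A.1

variable {Kstar : Set (Bundled.{w} (L.sum L').Structure)} {M : Type w} [L.Structure M]

/-- The set of `y ∈ Ω` which are expansions of `B` for which `π : A → B` is an embedding of the
expansion `x` of `A` into `y`. -/
def Extensions {A : FinSub L M} (x : Expansions Kstar A.1) (B : FinSub L M) (π : A.1 ↪[L] B.1) :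
    Set (Omega Kstar M) :=
  {y | ∃ F : Expansions Kstar B.1, IsExpansionEmbedding x.1 F.1 π ∧ y = ⟨B, F⟩}

/-- For finitely many relation symbols these sets are finite, so that the sum below is a sum over a
finite set. -/
theorem extensions_finite [L'.IsRelational] [Finite (Σ n, L'.Relations n)] {A : FinSub L M}
    (x : Expansions Kstar A.1) (B : FinSub L M) (π : A.1 ↪[L] B.1) :
    (Extensions x B π).Finite := by
  have hB : Finite B.1 := B.2.1
  have hfin : Finite (L'.Structure B.1) := by
    let φ : L'.Structure B.1 → (∀ R : (Σ n, L'.Relations n), (Fin R.1 → B.1) → Prop) :=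
      fun E R a => E.RelMap R.2 a
    apply Finite.of_injective φ
    intro E F h
    ext n f a
    · exact isEmptyElim f
    · exact iff_of_eq (congrFun (congrFun h ⟨n, f⟩) a)
  refine (Set.finite_range (fun F : Expansions Kstar B.1 => (⟨B, F⟩ : Omega Kstar M))).subset ?_
  rintro y ⟨F, -, rfl⟩
  exact ⟨F, rfl⟩

/-- The subspace `V` of the rational vector space with basis `Ω`, spanned by the differences
`x - ∑ y`, the sum being over the expansions `y` of `B` that extend `x` along `π : A → B`. -/
def V (Kstar : Set (Bundled.{w} (L.sum L').Structure)) (M : Type w) [L.Structure M] :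
    Submodule ℚ (Omega Kstar M →₀ ℚ) :=
  Submodule.span ℚ
    {v | ∃ (A B : FinSub L M) (x : Expansions Kstar A.1) (π : A.1 ↪[L] B.1),
      v = (Finsupp.single ⟨A, x⟩ 1 : Omega Kstar M →₀ ℚ) -
        ∑ᶠ y ∈ Extensions x B π, (Finsupp.single y 1 : Omega Kstar M →₀ ℚ)}

end VectorSpace

end CompanionClass

end

/-! Both conditions are equivalent to the existence of suitable weights on `Ω`: probability
distributions on the expansions of each finite substructure that are compatible with restriction
along embeddings. Compatibility says exactly that the induced functional vanishes on `V`.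

From amenability to signs: the expansions of `M` whose finite parts lie in `Kstar` form a nonempty
compact flow. An invariant measure on it weighs the cylinder of each `x`, and invariance with
ultrahomogeneity makes these weights annihilate `V`. Every weight is strictly positive
(`measureReal_restrict_pos`): by the expansion property, finitely many translates of any cylinder
cover the flow. A strictly positive functional that kills a nonzero `v` forces both signs on `v`.

From signs to amenability: `V` contains no nonzero nonnegative vector, so a Hahn–Banach argument
gives a positive functional vanishing on `V` (`exists_positive_functional`), that is, a consistent
weight. The weight is carried to an arbitrary flow by the Ramsey property
(`exists_homogeneous_embeddings`). Points of one orbit are indexed by embeddings of a finite `A`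
into `M` and coloured by approximate position. On suitable copies of a larger `D` the colour depends
only on the induced expansion of `A`, so averages against a consistent weight are almost invariant.
Compactness of states and the Riesz–Markov theorem give an invariant measure. -/

namespace CompanionClass

/-! ### Relational expansions and their embeddings. -/

section Structures

variable {L : FirstOrder.Language.{u, v}} {L' : FirstOrder.Language.{u', v'}}

/-- The pullback of a relational structure along a map. -/
@[reducible] def comapStructure [L'.IsRelational] {A B : Type w} (f : A → B) (F : L'.Structure B) :
    L'.Structure A where
  funMap c _ := isEmptyElim c
  RelMap R a := F.RelMap R (f ∘ a)

theorem structure_ext_of_isRelational [L'.IsRelational] {A : Type w} {E F : L'.Structure A}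
    (h : ∀ (n : ℕ) (R : L'.Relations n) (a : Fin n → A), E.RelMap R a ↔ F.RelMap R a) : E = F := by
  ext n f a
  · exact isEmptyElim f
  · exact h _ _ _

theorem finite_structure [L'.IsRelational] [Finite (Σ n, L'.Relations n)] (A : Type w) [Finite A] :
    Finite (L'.Structure A) := by
  let φ : L'.Structure A → (∀ R : (Σ n, L'.Relations n), (Fin R.1 → A) → Prop) :=
    fun E R a => E.RelMap R.2 a
  refine Finite.of_injective φ fun E F h => structure_ext_of_isRelational fun n R a => ?_
  exact iff_of_eq (congrFun (congrFun h ⟨n, R⟩) a)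

theorem isExpansionEmbedding_iff [L'.IsRelational] {A B : Type w} [L.Structure A] [L.Structure B]
    {E : L'.Structure A} {F : L'.Structure B} {f : A ↪[L] B} :
    IsExpansionEmbedding E F f ↔ comapStructure f F = E := by
  constructor
  · exact fun h => structure_ext_of_isRelational fun n R a => h n R a
  · rintro rfl n R a
    exact Iff.rfl

/-- An embedding of expansions, as an embedding of structures in the larger language. -/
def IsExpansionEmbedding.toEmbedding [L'.IsRelational] {A B : Type w} [L.Structure A]
    [L.Structure B] {E : L'.Structure A} {F : L'.Structure B} {f : A ↪[L] B}
    (h : IsExpansionEmbedding E F f) : expand (L := L) A E ↪[L.sum L'] expand (L := L) B F where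
  toFun := f
  inj' := f.injective
  map_fun' := by
    rintro n (c | c) a
    · exact f.map_fun c a
    · exact isEmptyElim c
  map_rel' := by
    rintro n (R | R) a
    · exact f.map_rel R a
    · exact h n R a

/-- The `L`-embedding underlying an embedding in the larger language. -/
def reductEmbedding {C D : Bundled.{w} (L.sum L').Structure} (i : C ↪[L.sum L'] D) :
    reduct C ↪[L] reduct D where
  toFun := i
  inj' := i.injective
  map_fun' {_} c a := i.map_fun (Sum.inl c : (L.sum L').Functions _) a
  map_rel' {_} R a := i.map_rel (Sum.inl R : (L.sum L').Relations _) a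

theorem exists_eq_expand [L'.IsRelational] (C : Bundled.{w} (L.sum L').Structure) :
    ∃ E : L'.Structure C, expand (L := L) (reduct C) E = C := by
  obtain ⟨C, s⟩ := C
  refine ⟨(LHom.sumInr : L' →ᴸ L.sum L').reduct C,
    congrArg (fun t => (⟨C, t⟩ : Bundled.{w} (L.sum L').Structure)) ?_⟩
  ext n c a
  · rcases c with c | c
    · rfl
    · exact isEmptyElim c
  · rcases c with c | c <;> exact Iff.rfl

/-- The `L`-embedding underlying an embedding of expansions. -/
def expandReductEmbedding {A B : Type w} [L.Structure A] [L.Structure B] {E : L'.Structure A}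
    {F : L'.Structure B} (i : expand (L := L) A E ↪[L.sum L'] expand (L := L) B F) : A ↪[L] B :=
  reductEmbedding i

theorem isExpansionEmbedding_expandReductEmbedding {A B : Type w} [L.Structure A] [L.Structure B]
    {E : L'.Structure A} {F : L'.Structure B} (i : expand (L := L) A E ↪[L.sum L'] expand (L := L) B F) :
    IsExpansionEmbedding E F (expandReductEmbedding i) :=
  fun _ R a => i.map_rel (Sum.inr R : (L.sum L').Relations _) a

end Structures

/-! ### Restriction of expansions and the generators of `V`. -/

section Expansions

variable {L : FirstOrder.Language.{u, v}} {L' : FirstOrder.Language.{u', v'}}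
variable {K : Set (Bundled.{w} L.Structure)} {Kstar : Set (Bundled.{w} (L.sum L').Structure)}
variable {M : Type w} [L.Structure M]

theorem comapStructure_mem_expansions [L'.IsRelational] (hKs : IsFraisseClass Kstar)
    {A B : Type w} [L.Structure A] [L.Structure B] [hA : Nonempty A] (f : A ↪[L] B)
    {F : L'.Structure B} (hF : F ∈ Expansions Kstar B) :
    comapStructure f F ∈ Expansions Kstar A :=
  hKs.hereditary _ _ hF hA ⟨(isExpansionEmbedding_iff (f := f).2 rfl).toEmbedding⟩

theorem IsExcellentPair.exists_expansion [L'.IsRelational] (hK : IsExcellentPair K Kstar)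
    {A : Bundled.{w} L.Structure} (hA : A ∈ K) :
    ∃ E : L'.Structure A, E ∈ Expansions (L := L) Kstar A := by
  rw [← hK.reduct_image] at hA
  obtain ⟨C, hC, rfl⟩ := hA
  obtain ⟨E, hE⟩ := exists_eq_expand C
  exact ⟨E, by rw [← hE] at hC; exact hC⟩

/-- The restriction of expansions of `B` along an embedding of `A` into `B`. -/
def restrict [L'.IsRelational] (hKs : IsFraisseClass Kstar) {A B : FinSub L M} (π : A.1 ↪[L] B.1)
    (F : Expansions Kstar B.1) : Expansions Kstar A.1 :=
  ⟨comapStructure π F.1, haveI := A.2.2; comapStructure_mem_expansions hKs π F.2⟩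

theorem isExpansionEmbedding_iff_restrict_eq [L'.IsRelational] (hKs : IsFraisseClass Kstar)
    {A B : FinSub L M} {x : Expansions Kstar A.1} {F : Expansions Kstar B.1} {π : A.1 ↪[L] B.1} :
    IsExpansionEmbedding x.1 F.1 π ↔ restrict hKs π F = x := by
  rw [isExpansionEmbedding_iff, Subtype.ext_iff]
  rfl

instance finite_expansions [L'.IsRelational] [Finite (Σ n, L'.Relations n)] (A : FinSub L M) :
    Finite (Expansions Kstar A.1) :=
  haveI := A.2.1
  haveI := finite_structure (L' := L') A.1
  inferInstance

noncomputable instance fintype_expansions [L'.IsRelational] [Finite (Σ n, L'.Relations n)]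
    (A : FinSub L M) : Fintype (Expansions Kstar A.1) :=
  Fintype.ofFinite _

/-- The element of `Ω` given by an expansion of a finite substructure. -/
def Omega.mk {A : FinSub L M} (x : Expansions Kstar A.1) : Omega Kstar M := ⟨A, x⟩

theorem Omega.mk_injective {A : FinSub L M} :
    Function.Injective (Omega.mk : Expansions Kstar A.1 → Omega Kstar M) :=
  fun _ _ h => eq_of_heq (Sigma.mk.inj h).2

open Classical in
theorem extensions_eq_image [L'.IsRelational] [Finite (Σ n, L'.Relations n)]
    (hKs : IsFraisseClass Kstar) {A B : FinSub L M} (x : Expansions Kstar A.1)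
    (π : A.1 ↪[L] B.1) :
    Extensions x B π =
      ((Finset.univ.filter fun F => restrict hKs π F = x).image Omega.mk :
        Finset (Omega Kstar M)) := by
  refine Set.ext fun y => ⟨?_, fun hy => ?_⟩
  · rintro ⟨F, hF, rfl⟩
    exact Finset.mem_image_of_mem Omega.mk (Finset.mem_filter.2
      ⟨Finset.mem_univ F, (isExpansionEmbedding_iff_restrict_eq hKs).1 hF⟩)
  · obtain ⟨F, hF, rfl⟩ := Finset.mem_image.1 hy
    exact ⟨F, (isExpansionEmbedding_iff_restrict_eq hKs).2 (Finset.mem_filter.1 hF).2, rfl⟩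

open Classical in
theorem finsum_extensions [L'.IsRelational] [Finite (Σ n, L'.Relations n)]
    (hKs : IsFraisseClass Kstar) {A B : FinSub L M} (x : Expansions Kstar A.1)
    (π : A.1 ↪[L] B.1) {E : Type*} [AddCommMonoid E] (h : Omega Kstar M → E) :
    ∑ᶠ y ∈ Extensions x B π, h y = ∑ F with restrict hKs π F = x, h (Omega.mk F) := by
  rw [extensions_eq_image hKs, finsum_mem_coe_finset, Finset.sum_image]
  exact fun F _ G _ hFG => Omega.mk_injective hFG

open Classical in
theorem sub_sum_restrict_mem_V [L'.IsRelational] [Finite (Σ n, L'.Relations n)]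
    (hKs : IsFraisseClass Kstar) {A B : FinSub L M} (x : Expansions Kstar A.1)
    (π : A.1 ↪[L] B.1) :
    Finsupp.single (Omega.mk x) (1 : ℚ) -
      ∑ F with restrict hKs π F = x, Finsupp.single (Omega.mk F) 1 ∈ V Kstar M := by
  refine Submodule.subset_span ⟨A, B, x, π, ?_⟩
  rw [finsum_extensions hKs]
  rfl

end Expansions

/-! ### Finite substructures and automorphisms of the limit. -/

section Limit

variable {L : FirstOrder.Language.{u, v}} {K : Set (Bundled.{w} L.Structure)}
variable {M : Type w} [L.Structure M]

theorem IsLimit.exists_finSub_subset (hM : IsLimit K M) {s : Set M} (hs : s.Finite) :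
    ∃ A : FinSub L M, s ⊆ A.1 := by
  -- The extra point keeps the closure nonempty when `s` is empty.
  obtain ⟨m⟩ := hM.infinite.nonempty
  refine ⟨⟨Substructure.closure L (insert m s), hM.locally_finite _ ?_, ?_⟩, ?_⟩
  · exact Substructure.fg_closure (hs.insert m)
  · exact ⟨m, Substructure.subset_closure (Set.mem_insert _ _)⟩
  · exact (Set.subset_insert _ _).trans Substructure.subset_closure

theorem IsLimit.exists_finSub_le (hM : IsLimit K M) (A B : FinSub L M) :
    ∃ C : FinSub L M, A.1 ≤ C.1 ∧ B.1 ≤ C.1 := by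
  have := A.2.1
  have := B.2.1
  obtain ⟨C, hC⟩ := hM.exists_finSub_subset
    ((Set.toFinite (A.1 : Set M)).union (Set.toFinite (B.1 : Set M)))
  exact ⟨C, Set.subset_union_left.trans hC, Set.subset_union_right.trans hC⟩

theorem IsLimit.finSub_mem (hM : IsLimit K M) (A : FinSub L M) :
    (⟨A.1, inferInstance⟩ : Bundled.{w} L.Structure) ∈ K := by
  rw [← hM.age_eq]
  exact ⟨A.2.1, A.2.2, ⟨A.1.subtype⟩⟩

theorem IsLimit.exists_aut (hM : IsLimit K M) {A : FinSub L M} (f : A.1 ↪[L] M) :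
    ∃ g : Aut L M, ∀ a : A.1, g.toFun a = f a := by
  have := A.2.1
  obtain ⟨g, hg⟩ := hM.ultrahomogeneous A.1
    ((Substructure.fg_iff_structure_fg _).2 Structure.FG.of_finite) f
  exact ⟨g, fun a => by rw [hg]; rfl⟩

/-- The restriction of an automorphism to an embedding between finite substructures. -/
def Aut.restrictEmbedding (g : Aut L M) (A B : FinSub L M) (h : ∀ a ∈ A.1, g.toFun a ∈ B.1) :
    A.1 ↪[L] B.1 :=
  Embedding.codRestrict B.1 ((show M ≃[L] M from g).toEmbedding.comp A.1.subtype)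
    fun a => h a a.2

theorem Aut.mul_toFun (g h : Aut L M) (a : M) : (g * h).toFun a = g.toFun (h.toFun a) := rfl

theorem Aut.one_toFun (a : M) : (1 : Aut L M).toFun a = a := rfl

theorem Aut.inv_toFun_toFun (g : Aut L M) (a : M) : g⁻¹.toFun (g.toFun a) = a := by
  rw [← Aut.mul_toFun, inv_mul_cancel, Aut.one_toFun]

theorem Aut.toFun_inv_toFun (g : Aut L M) (a : M) : g.toFun (g⁻¹.toFun a) = a := by
  rw [← Aut.mul_toFun, mul_inv_cancel, Aut.one_toFun]

open Topology in
-- A basic neighbourhood of the identity constrains only finitely many points, and by local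
-- finiteness these lie in a finite substructure.
theorem IsLimit.exists_stabilizer_subset (hM : IsLimit K M) {U : Set (Aut L M)}
    (hU : U ∈ 𝓝 (1 : Aut L M)) :
    ∃ A : FinSub L M, ∀ s : Aut L M, (∀ a ∈ A.1, s.toFun a = a) → s ∈ U := by
  rw [nhds_iInf, Filter.mem_iInf] at hU
  obtain ⟨I, hI, W, hW, rfl⟩ := hU
  obtain ⟨A, hA⟩ := hM.exists_finSub_subset hI
  refine ⟨A, fun s hs => Set.mem_iInter.2 fun i => ?_⟩
  have := hW i
  rw [@nhds_induced _ _ ⊥, @nhds_discrete M ⊥ (@DiscreteTopology.mk M ⊥ rfl), Filter.comap_pure,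
    Filter.mem_principal] at this
  exact this (hs i (hA i.2))

end Limit

/-! ### The expansion property inside the limit. -/

section Limit

variable {L : FirstOrder.Language.{u, v}} {L' : FirstOrder.Language.{u', v'}}
variable {K : Set (Bundled.{w} L.Structure)} {Kstar : Set (Bundled.{w} (L.sum L').Structure)}
variable {M : Type w} [L.Structure M]

/-- For each expansion `x` of `A` there is `B` such that `x` embeds into each expansion of `B`. -/
theorem IsExcellentPair.exists_embedding_restrict_eq [L'.IsRelational]
    (hK : IsExcellentPair K Kstar) (hM : IsLimit K M)
    {A : FinSub L M} (x : Expansions Kstar A.1) :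
    ∃ B : FinSub L M, ∀ F : Expansions Kstar B.1, ∃ π : A.1 ↪[L] B.1,
      restrict hK.fraisse_star π F = x := by
  obtain ⟨C, hC, hemb⟩ := hK.expansion _ (hM.finSub_mem A)
  have hCM := hC
  rw [← hM.age_eq] at hCM
  obtain ⟨hfin, hne, ⟨m⟩⟩ := hCM
  let e := m.equivRange
  refine ⟨⟨m.toHom.range, Finite.of_equiv _ e.toEquiv, hne.map e⟩, fun F => ?_⟩
  -- The expansion property concerns expansions of `C` itself, so `F` is pulled back from the copy
  -- of `C` in `M`.
  obtain ⟨i⟩ := hemb _ x.2 _ (comapStructure_mem_expansions hK.fraisse_star e.toEmbedding F.2)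
    rfl rfl
  refine ⟨e.toEmbedding.comp (expandReductEmbedding i), Subtype.ext ?_⟩
  exact isExpansionEmbedding_iff.1 (isExpansionEmbedding_expandReductEmbedding i)

end Limit

/-! ### Positive functionals vanishing on a rational subspace. -/

section Separation

/-- Finitely many positive reals are mapped to positive rationals by some `ℚ`-linear map. -/
theorem exists_rat_linearMap_pos (s : Finset ℝ) (hs : ∀ r ∈ s, 0 < r) :
    ∃ ψ : ℝ →ₗ[ℚ] ℚ, ∀ r ∈ s, 0 < ψ r := by
  let W : Submodule ℚ ℝ := Submodule.span ℚ (s : Set ℝ)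
  have : FiniteDimensional ℚ W := FiniteDimensional.span_finset ℚ s
  let b := Module.finBasis ℚ W
  have hmem : ∀ r ∈ s, r ∈ W := fun r hr => Submodule.subset_span hr
  let ev : (r : s) → (Fin (Module.finrank ℚ W) → ℝ) → ℝ :=
    fun r c => ∑ j, ((b.repr ⟨r, hmem r r.2⟩ j : ℚ) : ℝ) * c j
  have hev : ∀ r : s, ev r (fun j => (b j : ℝ)) = r := by
    intro r
    have := congrArg (Submodule.subtype W) (b.sum_repr ⟨r, hmem r r.2⟩)
    rw [map_sum] at this
    simpa [ev, Rat.smul_def] using this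
  have hopen : IsOpen {c | ∀ r : s, 0 < ev r c} := by
    simp only [Set.ofPred_forall]
    refine isOpen_iInter_of_finite fun r => isOpen_lt continuous_const ?_
    exact continuous_finsetSum _ fun j _ => continuous_const.mul (continuous_apply j)
  -- The real values of the basis vectors satisfy finitely many strict inequalities. This is an open
  -- condition, so nearby rational values satisfy them too and define `ψ` on `W`.
  have hdense : DenseRange (fun (q : Fin (Module.finrank ℚ W) → ℚ) j => ((q j : ℚ) : ℝ)) :=
    DenseRange.piMap fun _ => Rat.denseRange_cast
  obtain ⟨q, hq⟩ := hdense.exists_mem_open hopen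
    ⟨fun j => (b j : ℝ), fun r => by rw [hev]; exact hs r r.2⟩
  obtain ⟨ψ, hψ⟩ := (b.constr ℚ q).exists_extend
  refine ⟨ψ, fun r hr => ?_⟩
  have h1 : ψ r = b.constr ℚ q ⟨r, hmem r hr⟩ := by
    rw [← hψ]
    rfl
  have h2 := hq ⟨r, hr⟩
  rw [h1, Module.Basis.constr_apply_fintype]
  simp only [ev, Module.Basis.equivFun_apply, smul_eq_mul] at h2 ⊢
  exact_mod_cast h2

variable {Ω : Type*}

/-- The real span of a rational subspace. -/
noncomputable def realSpan (V : Submodule ℚ (Ω →₀ ℚ)) : Submodule ℝ (Ω →₀ ℝ) :=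
  Submodule.span ℝ (Finsupp.mapRange (fun q : ℚ => (q : ℝ)) Rat.cast_zero '' (V : Set (Ω →₀ ℚ)))

/-- Applied to coefficients, `ψ` sends a rational vector `v` to `ψ 1 • v`. A real scalar is absorbed
by precomposing `ψ` with multiplication, which is why `ψ` varies in the induction. -/
theorem mapRange_mem_of_mem_realSpan {V : Submodule ℚ (Ω →₀ ℚ)} {r : Ω →₀ ℝ}
    (hr : r ∈ realSpan V) (ψ : ℝ →ₗ[ℚ] ℚ) : r.mapRange ψ (map_zero ψ) ∈ V := by
  induction hr using Submodule.span_induction generalizing ψ with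
  | mem r hr =>
    obtain ⟨v, hv, rfl⟩ := hr
    convert V.smul_mem (ψ 1) hv using 1
    ext x
    have := ψ.map_smul (v x) 1
    simpa [Rat.smul_def, mul_comm] using this
  | zero =>
    rw [Finsupp.mapRange_zero]
    exact V.zero_mem
  | add r r' _ _ h h' =>
    rw [Finsupp.mapRange_add (map_add ψ)]
    exact V.add_mem (h ψ) (h' ψ)
  | smul c r _ h =>
    convert h (ψ ∘ₗ (LinearMap.lsmul ℝ ℝ c).restrictScalars ℚ) using 1
    ext x
    simp

/-- Passing to the real span creates no new nonnegative vectors: a `ψ` that is positive on the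
nonzero coefficients of `r` turns `r` into a nonnegative element of `V` with the same support. -/
theorem eq_zero_of_mem_realSpan {V : Submodule ℚ (Ω →₀ ℚ)} (hV : ∀ v ∈ V, 0 ≤ v → v = 0)
    {r : Ω →₀ ℝ} (hr : r ∈ realSpan V) (h0 : 0 ≤ r) : r = 0 := by
  classical
  obtain ⟨ψ, hψ⟩ := exists_rat_linearMap_pos (r.support.image r) (by
    intro a ha
    obtain ⟨x, hx, rfl⟩ := Finset.mem_image.1 ha
    exact lt_of_le_of_ne (h0 x) (Finsupp.mem_support_iff.1 hx).symm)
  have hpos : ∀ x, r x ≠ 0 → 0 < ψ (r x) := fun x hx =>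
    hψ _ (Finset.mem_image_of_mem _ (Finsupp.mem_support_iff.2 hx))
  have hz := hV _ (mapRange_mem_of_mem_realSpan hr ψ) (by
    intro x
    by_cases hx : r x = 0
    · simp [hx]
    · simpa using (hpos x hx).le)
  ext x
  by_contra hx
  have := DFunLike.congr_fun hz x
  simp only [Finsupp.mapRange_apply, Finsupp.coe_zero, Pi.zero_apply] at this
  exact (hpos x hx).ne' this

/-- A rational subspace without nonzero nonnegative elements is annihilated by a nonnegative
additive functional, normalized at an element which dominates each basis vector modulo the subspace. -/
theorem exists_positive_functional {V : Submodule ℚ (Ω →₀ ℚ)} (hV : ∀ v ∈ V, 0 ≤ v → v = 0) {e : Ω →₀ ℚ}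
    (he : 0 ≤ e) (he0 : e ≠ 0) (hdom : ∀ x, ∃ v ∈ V, Finsupp.single x 1 + v ≤ e) :
    ∃ φ : (Ω →₀ ℚ) →+ ℝ, (∀ x, 0 ≤ φ (Finsupp.single x 1)) ∧ (∀ v ∈ V, φ v = 0) ∧ φ e = 1 := by
  let ι : (Ω →₀ ℚ) →+ (Ω →₀ ℝ) := Finsupp.mapRange.addMonoidHom (Rat.castHom ℝ).toAddMonoidHom
  have hι : ∀ v x, ι v x = (v x : ℝ) := fun v x => rfl
  have hιV : ∀ v ∈ V, ι v ∈ realSpan V := fun v hv => Submodule.subset_span ⟨v, hv, rfl⟩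
  -- The cone is the nonnegative orthant plus the real span of `V`. A functional that is nonnegative
  -- on it is positive and vanishes on `V`.
  let C : PointedCone ℝ (Ω →₀ ℝ) :=
    { carrier := {w | ∃ v ∈ realSpan V, v ≤ w}
      add_mem' := by
        rintro a b ⟨v, hv, hva⟩ ⟨w, hw, hwb⟩
        exact ⟨v + w, add_mem hv hw, add_le_add hva hwb⟩
      zero_mem' := ⟨0, zero_mem _, le_rfl⟩
      smul_mem' := by
        rintro c a ⟨v, hv, hva⟩
        exact ⟨(c : ℝ) • v, Submodule.smul_mem _ _ hv, fun x => by
          exact mul_le_mul_of_nonneg_left (hva x) c.2⟩ }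
  have hC : ∀ w, w ∈ C ↔ ∃ v ∈ realSpan V, v ≤ w := fun w => Iff.rfl
  have hιe : ι e ≠ 0 := by
    intro h
    apply he0
    ext x
    have := DFunLike.congr_fun h x
    rw [hι, Finsupp.zero_apply] at this
    exact_mod_cast this
  have hιe' : 0 ≤ ι e := fun x => by
    have := he x
    rw [Finsupp.zero_apply] at this
    rw [hι, Finsupp.zero_apply]
    exact_mod_cast this
  let f : (Ω →₀ ℝ) →ₗ.[ℝ] ℝ := LinearPMap.mkSpanSingleton (ι e) 1 hιe
  have hunit : ∀ y : Ω →₀ ℝ, ∃ t : ℝ, t • ι e + y ∈ C := by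
    intro y
    induction y using Finsupp.induction_linear with
    | zero => exact ⟨0, by simp⟩
    | add a b ha hb =>
      obtain ⟨s, hs⟩ := ha
      obtain ⟨t, ht⟩ := hb
      refine ⟨s + t, ?_⟩
      convert add_mem hs ht using 1
      rw [add_smul]
      abel
    | single x c =>
      obtain ⟨v, hv, hle⟩ := hdom x
      -- If `v` witnesses domination at `x`, then `|c| • (e - v)` dominates `|c|` times the basis
      -- vector, hence also `-c` times it.
      refine ⟨|c|, (hC _).2 ⟨|c| • ι v, Submodule.smul_mem _ _ (hιV v hv), ?_⟩⟩
      intro z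
      have h1 : (ι (Finsupp.single x 1) z : ℝ) + v z ≤ e z := by
        have := hle z
        rw [hι]
        exact_mod_cast this
      have h2 : (Finsupp.single x c : Ω →₀ ℝ) z = c * ι (Finsupp.single x 1) z := by
        classical
        rw [hι, Finsupp.single_apply, Finsupp.single_apply]
        split_ifs <;> simp
      have h3 : (0 : ℝ) ≤ ι (Finsupp.single x 1) z := by
        classical
        rw [hι, Finsupp.single_apply]
        split_ifs <;> simp
      simp only [Finsupp.coe_smul, Pi.smul_apply, Finsupp.coe_add, Pi.add_apply, smul_eq_mul, h2,
        hι v, hι e]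
      nlinarith [mul_le_mul_of_nonneg_left h1 (abs_nonneg c),
        mul_le_mul_of_nonneg_right (neg_abs_le c) h3]
  obtain ⟨g, hgf, hgC⟩ := riesz_extension C f
    (by
      rintro ⟨x, hx⟩ hxC
      obtain ⟨t, rfl⟩ := Submodule.mem_span_singleton.1 hx
      have hft : f ⟨t • ι e, hx⟩ = t :=
        (LinearPMap.mkSpanSingleton'_apply (ι e) (1 : ℝ) _ t hx).trans (mul_one t)
      rw [hft]
      -- If `t < 0` and `v ≤ t • ι e`, then `-v` is nonnegative in the real span, so `v = 0`, which
      -- forces `ι e = 0`.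
      by_contra! ht
      obtain ⟨v, hv, hle⟩ := (hC _).1 hxC
      have hneg : 0 ≤ -v := fun z => by
        have h1 := hle z
        have h2 := hιe' z
        simp only [Finsupp.coe_smul, Pi.smul_apply, smul_eq_mul, Finsupp.coe_zero, Pi.zero_apply,
          Finsupp.coe_neg, Pi.neg_apply] at h1 h2 ⊢
        nlinarith
      have hv0 : v = 0 := neg_eq_zero.1 (eq_zero_of_mem_realSpan hV (neg_mem hv) hneg)
      apply hιe
      ext z
      have h1 := hle z
      have h2 := hιe' z
      simp only [hv0, Finsupp.coe_smul, Pi.smul_apply, smul_eq_mul, Finsupp.coe_zero,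
        Pi.zero_apply] at h1 h2 ⊢
      nlinarith)
    (by
      intro y
      obtain ⟨t, ht⟩ := hunit y
      exact ⟨⟨t • ι e, Submodule.mem_span_singleton.2 ⟨t, rfl⟩⟩, ht⟩)
  refine ⟨g.toAddMonoidHom.comp ι, fun x => ?_, fun v hv => ?_, ?_⟩
  · refine hgC _ ((hC _).2 ⟨0, zero_mem _, fun z => ?_⟩)
    classical
    rw [hι, Finsupp.single_apply]
    split_ifs <;> simp
  · change g (ι v) = 0
    apply le_antisymm
    · have := hgC (-ι v) ((hC _).2 ⟨_, neg_mem (hιV v hv), le_rfl⟩)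
      rw [map_neg] at this
      linarith
    · exact hgC (ι v) ((hC _).2 ⟨_, hιV v hv, le_rfl⟩)
  · have h := hgf ⟨ι e, Submodule.mem_span_singleton_self _⟩
    have hfe : f ⟨ι e, Submodule.mem_span_singleton_self _⟩ = 1 :=
      LinearPMap.mkSpanSingleton_apply ℝ ℝ hιe 1
    exact h.trans hfe

end Separation

/-! ### The Ramsey property for embeddings of rigid structures. -/

section EmbeddingRamsey

variable {L : FirstOrder.Language.{u, v}} {K : Set (Bundled.{w} L.Structure)}

/-- Two isomorphisms onto the same structure differ by an automorphism. Hence each copy of a rigid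
`A` is the range of exactly one embedding, and colouring copies amounts to colouring embeddings. -/
theorem ConsistsOfRigid.equiv_eq (hr : ConsistsOfRigid K) {A : Bundled.{w} L.Structure}
    (hA : A ∈ K) {N : Type*} [L.Structure N] (e e' : A ≃[L] N) : e = e' := by
  ext a
  have := hr A hA (e'.symm.comp e) a
  rw [Language.Equiv.comp_apply] at this
  rw [← this, e'.apply_symm_apply, this]

/-- The Ramsey property of a class of rigid structures, for colorings of embeddings. -/
theorem RamseyProperty.embeddings (hR : RamseyProperty K) (hr : ConsistsOfRigid K)
    {A B : Bundled.{w} L.Structure} (hA : A ∈ K) (hB : B ∈ K) (κ : Type*) [Finite κ] :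
    ∃ C ∈ K, ∀ χ : (A ↪[L] C) → κ, ∃ j : B ↪[L] C, ∀ i i' : A ↪[L] B,
      χ (j.comp i) = χ (j.comp i') := by
  by_cases hAB : Nonempty (A ↪[L] B)
  swap
  · exact ⟨B, hB, fun χ => ⟨Embedding.refl L B, fun i => (hAB ⟨i⟩).elim⟩⟩
  -- The maximum with 2 is needed because the Ramsey property is stated for at least two colours.
  obtain ⟨C, hC, -, hcol⟩ := hR A hA B hB hAB (max 2 (Nat.card κ)) (le_max_left _ _)
  refine ⟨C, hC, fun χ => ?_⟩
  let emb : Copies C A → (A ↪[L] C) :=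
    fun S => S.1.subtype.comp (Classical.choice S.2).symm.toEmbedding
  let toFin : κ → Fin (max 2 (Nat.card κ)) :=
    fun c => Fin.castLE (le_max_right _ _) (Finite.equivFin κ c)
  have htoFin : Function.Injective toFin :=
    (Fin.castLE_injective _).comp (Finite.equivFin κ).injective
  obtain ⟨B₀, ⟨hB₀⟩, hmono⟩ := hcol fun S => toFin (χ (emb S))
  let j : B ↪[L] C := B₀.subtype.comp hB₀.symm.toEmbedding
  have hcopy : ∀ i : A ↪[L] B, ∃ S : Copies C A, S.1 ≤ B₀ ∧ emb S = j.comp i := by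
    intro i
    let f := j.comp i
    refine ⟨⟨f.toHom.range, ⟨f.equivRange.symm⟩⟩, ?_, ?_⟩
    · rintro _ ⟨a, rfl⟩
      exact (hB₀.symm (i a)).2
    · have := hr.equiv_eq hA
        (Classical.choice (⟨f.equivRange.symm⟩ : Nonempty (f.toHom.range ≃[L] A))).symm
        f.equivRange
      ext a
      exact congrArg Subtype.val (DFunLike.congr_fun this a)
  refine ⟨j, fun i i' => ?_⟩
  obtain ⟨S, hS, hSi⟩ := hcopy i
  obtain ⟨T, hT, hTi⟩ := hcopy i'
  rw [← hSi, ← hTi]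
  exact htoFin (hmono S T hS hT)

/-- The Ramsey property for simultaneous colorings of the embeddings of finitely many structures. -/
theorem RamseyProperty.embeddings_finset (hR : RamseyProperty K) (hr : ConsistsOfRigid K)
    {ι : Type*} (A : ι → Bundled.{w} L.Structure) (hA : ∀ x, A x ∈ K)
    {B : Bundled.{w} L.Structure} (hB : B ∈ K) (κ : Type*) [Finite κ] (s : Finset ι) :
    ∃ C ∈ K, ∀ χ : ∀ x, (A x ↪[L] C) → κ, ∃ j : B ↪[L] C, ∀ x ∈ s, ∀ i i' : A x ↪[L] B,
      χ x (j.comp i) = χ x (j.comp i') := by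
  classical
  induction s using Finset.induction_on with
  | empty => exact ⟨B, hB, fun χ => ⟨Embedding.refl L B, by simp⟩⟩
  | insert x s _ ih =>
    obtain ⟨C, hC, hcol⟩ := ih
    obtain ⟨D, hD, hcol'⟩ := hR.embeddings hr (hA x) hC κ
    refine ⟨D, hD, fun χ => ?_⟩
    obtain ⟨j₁, hj₁⟩ := hcol' (χ x)
    -- The copy `j₁` of `C` is already homogeneous for `x`, and so is any copy of `B` inside it. The
    -- remaining colourings are pulled back to `C`.
    obtain ⟨j₂, hj₂⟩ := hcol fun y i => χ y (j₁.comp i)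
    refine ⟨j₁.comp j₂, fun y hy i i' => ?_⟩
    rcases Finset.mem_insert.1 hy with rfl | hy
    · exact hj₁ (j₂.comp i) (j₂.comp i')
    · exact hj₂ y hy i i'

theorem exists_joint_embedding (hK : JointEmbedding K) (hne : K.Nonempty) {ι : Type*}
    (A : ι → Bundled.{w} L.Structure) (hA : ∀ x, A x ∈ K) (s : Finset ι) :
    ∃ B ∈ K, ∀ x ∈ s, Nonempty (A x ↪[L] B) := by
  classical
  induction s using Finset.induction_on with
  | empty => exact ⟨hne.some, hne.some_mem, by simp⟩
  | insert x s _ ih =>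
    obtain ⟨B, hB, hemb⟩ := ih
    obtain ⟨C, hC, ⟨f⟩, ⟨g⟩⟩ := hK (A x) (hA x) B hB
    refine ⟨C, hC, fun y hy => ?_⟩
    rcases Finset.mem_insert.1 hy with rfl | hy
    · exact ⟨f⟩
    · obtain ⟨h⟩ := hemb y hy
      exact ⟨g.comp h⟩

end EmbeddingRamsey

/-! ### Homogeneous copies in the limit. -/

section LimitRamsey

variable {L : FirstOrder.Language.{u, v}} {L' : FirstOrder.Language.{u', v'}}
variable [L'.IsRelational] [Finite (Σ n, L'.Relations n)]
variable {K : Set (Bundled.{w} L.Structure)} {Kstar : Set (Bundled.{w} (L.sum L').Structure)}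
variable {M : Type w} [L.Structure M]

/-- For each finite coloring of the embeddings of `A` into the limit, and each `D`, there are copies
of `D` in the limit, one for each expansion of `D`, in which the color of a copy of `A` depends
only on the induced expansion of `A`. -/
theorem IsExcellentPair.exists_homogeneous_embeddings (hK : IsExcellentPair K Kstar)
    (hM : IsLimit K M) (A D : FinSub L M) {κ : Type*} [Finite κ] (χ : (A.1 ↪[L] M) → κ) :
    ∃ (c : Expansions Kstar A.1 → κ) (e : Expansions Kstar D.1 → (D.1 ↪[L] M)),
      ∀ (y : Expansions Kstar D.1) (i : A.1 ↪[L] D.1),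
        χ ((e y).comp i) = c (restrict hK.fraisse_star i y) := by
  obtain ⟨C₀, hC₀, -⟩ := hK.fraisse_star.arbitrarily_large 0
  -- `B` contains every expansion of `D`, so one homogeneous copy of `B` serves them all with a
  -- common colour for each expansion of `A`.
  obtain ⟨B, hB, hDB⟩ := exists_joint_embedding hK.fraisse_star.jointEmbedding ⟨C₀, hC₀⟩
    (fun y : Expansions Kstar D.1 => expand (L := L) D.1 y.1) (fun y => y.2) Finset.univ
  obtain ⟨C, hC, hcol⟩ := hK.ramsey.embeddings_finset hK.rigid
    (fun x : Expansions Kstar A.1 => expand (L := L) A.1 x.1) (fun x => x.2) hB κ Finset.univ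
  have hCK : reduct C ∈ K := by
    rw [← hK.reduct_image]
    exact ⟨C, hC, rfl⟩
  rw [← hM.age_eq] at hCK
  obtain ⟨-, -, ⟨m⟩⟩ := hCK
  obtain ⟨j, hj⟩ := hcol fun _ i => χ (m.comp (reductEmbedding i))
  let d : ∀ y : Expansions Kstar D.1, expand (L := L) D.1 y.1 ↪[L.sum L'] B :=
    fun y => Classical.choice (hDB y (Finset.mem_univ y))
  let e : Expansions Kstar D.1 → (D.1 ↪[L] M) :=
    fun y => m.comp (reductEmbedding (j.comp (d y)))
  have hne : Nonempty κ := by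
    obtain ⟨f⟩ : Nonempty (A.1 ↪[L] M) := ⟨A.1.subtype⟩
    exact ⟨χ f⟩
  classical
  -- The default colour is used only for expansions of `A` that do not embed in `B`. These never
  -- arise by restriction from an expansion of `D`.
  let c : Expansions Kstar A.1 → κ := fun x =>
    if h : Nonempty (expand (L := L) A.1 x.1 ↪[L.sum L'] B) then
      χ (m.comp (reductEmbedding (j.comp h.some))) else Classical.choice hne
  refine ⟨c, e, fun y i => ?_⟩
  have hi : IsExpansionEmbedding (restrict hK.fraisse_star i y).1 y.1 i :=
    (isExpansionEmbedding_iff_restrict_eq hK.fraisse_star).2 rfl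
  have h : Nonempty (expand (L := L) A.1 (restrict hK.fraisse_star i y).1 ↪[L.sum L'] B) :=
    ⟨(d y).comp hi.toEmbedding⟩
  have hc : c (restrict hK.fraisse_star i y) = χ (m.comp (reductEmbedding (j.comp h.some))) :=
    dif_pos h
  rw [hc, ← hj _ (Finset.mem_univ _) ((d y).comp hi.toEmbedding) h.some]
  rfl

end LimitRamsey

/-! ### From approximately invariant states to invariant measures. -/

section InvariantMeasure

open Topology Filter CompactlySupported

/-- A function on a group translated by a homeomorphism of the space acted on. -/
def translate {G X : Type*} [SMul G X] [TopologicalSpace X] [ContinuousConstSMul G X]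
    (g : G) (f : C(X, ℝ)) : C(X, ℝ) :=
  f.comp ⟨fun x => g • x, continuous_const_smul g⟩

variable {G X : Type*} [Group G] [TopologicalSpace X] [CompactSpace X] [MulAction G X]
  [ContinuousConstSMul G X]

theorem abs_le_norm_of_nonneg {ν : C(X, ℝ) →ₗ[ℝ] ℝ} (hpos : ∀ f, 0 ≤ f → 0 ≤ ν f)
    (hone : ν 1 = 1) (f : C(X, ℝ)) : |ν f| ≤ ‖f‖ := by
  have hle : ∀ f : C(X, ℝ), ν f ≤ ‖f‖ := by
    intro f
    have h := hpos (‖f‖ • (1 : C(X, ℝ)) - f) fun x => by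
      have := (le_abs_self _).trans (f.norm_coe_le_norm x)
      simpa using this
    rw [map_sub, map_smul, hone, smul_eq_mul, mul_one] at h
    linarith
  refine abs_le.2 ⟨?_, hle f⟩
  have := hle (-f)
  rw [map_neg, norm_neg] at this
  linarith

/-- Approximately invariant states accumulate at an invariant state. -/
theorem exists_invariant_state
    (happ : ∀ (S : Finset C(X, ℝ)) (T : Finset G) (ε : ℝ), 0 < ε → ∃ ν : C(X, ℝ) →ₗ[ℝ] ℝ,
      (∀ f, 0 ≤ f → 0 ≤ ν f) ∧ ν 1 = 1 ∧ ∀ f ∈ S, ∀ g ∈ T, |ν (translate g f) - ν f| ≤ ε) :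
    ∃ Λ : C(X, ℝ) →ₗ[ℝ] ℝ, (∀ f, 0 ≤ f → 0 ≤ Λ f) ∧ Λ 1 = 1 ∧
      ∀ (g : G) f, Λ (translate g f) = Λ f := by
  classical
  choose ν hpos hone hinv using
    fun i : Finset C(X, ℝ) × Finset G × ℕ => happ i.1 i.2.1 (1 / (i.2.2 + 1)) (by positivity)
  -- For each `f` the values `ν i f` stay in `[-‖f‖, ‖f‖]`, so they converge along any ultrafilter.
  -- Refining `atTop` makes every invariance requirement hold eventually, with arbitrarily small
  -- error.
  let U : Ultrafilter (Finset C(X, ℝ) × Finset G × ℕ) := Ultrafilter.of atTop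
  have hU : (U : Filter (Finset C(X, ℝ) × Finset G × ℕ)) ≤ atTop := Ultrafilter.of_le _
  have hlim : ∀ f, ∃ l, Tendsto (fun i => ν i f) U (𝓝 l) := by
    intro f
    obtain ⟨l, -, hl⟩ := (isCompact_Icc (a := -‖f‖) (b := ‖f‖)).ultrafilter_le_nhds
      (U.map fun i => ν i f) (by
        refine le_principal_iff.2 (Ultrafilter.mem_map.2 (univ_mem' fun i => ?_))
        exact abs_le.1 (abs_le_norm_of_nonneg (hpos i) (hone i) f))
    exact ⟨l, hl⟩
  choose Λ hΛ using hlim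
  refine ⟨⟨⟨Λ, fun f g => ?_⟩, fun c f => ?_⟩, fun f hf => ?_, ?_, fun g f => ?_⟩
  · refine tendsto_nhds_unique (hΛ (f + g)) (((hΛ f).add (hΛ g)).congr fun i => ?_)
    exact ((ν i).map_add f g).symm
  · refine tendsto_nhds_unique (hΛ (c • f)) (((hΛ f).const_mul c).congr fun i => ?_)
    exact ((ν i).map_smul c f).symm
  · exact ge_of_tendsto' (hΛ f) fun i => hpos i f hf
  · exact tendsto_nhds_unique (hΛ 1) (tendsto_const_nhds.congr fun i => (hone i).symm)
  · have h1 := ((hΛ (translate g f)).sub (hΛ f)).abs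
    refine sub_eq_zero.1 (abs_eq_zero.1 (le_antisymm ?_ (abs_nonneg _)))
    refine le_of_forall_pos_le_add fun ε hε => ?_
    obtain ⟨n, hn⟩ := exists_nat_one_div_lt hε
    rw [zero_add]
    refine le_of_tendsto h1 (hU ?_)
    filter_upwards [eventually_ge_atTop (({f}, {g}, n) : Finset C(X, ℝ) × Finset G × ℕ)] with i hi
    refine (hinv i f (hi.1 (Finset.mem_singleton_self f)) g
      (hi.2.1 (Finset.mem_singleton_self g))).trans (le_trans ?_ hn.le)
    exact one_div_le_one_div_of_le (by positivity)
      (by have : (n : ℝ) ≤ i.2.2 := Nat.cast_le.2 hi.2.2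
          linarith)

/-- The Riesz–Markov measure and its image under `g` are both regular and integrate continuous
functions alike, so they coincide. -/
theorem exists_invariant_measure [T2Space X] [MeasurableSpace X] [BorelSpace X]
    {Λ : C(X, ℝ) →ₗ[ℝ] ℝ} (hpos : ∀ f, 0 ≤ f → 0 ≤ Λ f) (hone : Λ 1 = 1)
    (hinv : ∀ (g : G) f, Λ (translate g f) = Λ f) :
    ∃ μ : Measure X, IsProbabilityMeasure μ ∧ SMulInvariantMeasure G X μ := by
  let Λ' : C_c(X, ℝ) →ₚ[ℝ] ℝ := PositiveLinearMap.mk₀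
    { toFun := fun f => Λ f.toContinuousMap
      map_add' := fun f g => Λ.map_add f.toContinuousMap g.toContinuousMap
      map_smul' := fun c f => Λ.map_smul c f.toContinuousMap }
    fun f hf => hpos f.toContinuousMap hf
  let μ := RealRMK.rieszMeasure Λ'
  have hint : ∀ f : C(X, ℝ), ∫ x, f x ∂μ = Λ f := fun f =>
    RealRMK.integral_rieszMeasure Λ' ⟨f, HasCompactSupport.of_compactSpace f⟩
  have hreg : μ.Regular := RealRMK.regular_rieszMeasure Λ'
  have hfin : IsFiniteMeasure μ := inferInstance
  refine ⟨μ, ⟨?_⟩, ⟨fun g s hs => ?_⟩⟩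
  · have h := hint 1
    rw [hone] at h
    simp only [ContinuousMap.one_apply, integral_const, smul_eq_mul, mul_one] at h
    rw [← ENNReal.toReal_eq_one_iff]
    exact h
  · have hmap : μ.map (Homeomorph.smul g) = μ := by
      have : (μ.map (Homeomorph.smul g)).Regular := Measure.Regular.map (Homeomorph.smul g)
      refine Measure.ext_of_integral_eq_on_compactlySupported fun f => ?_
      refine (integral_map (f := ⇑f) (Homeomorph.smul g).continuous.aemeasurable
        f.continuous.aestronglyMeasurable).trans ?_
      exact (hint (translate g f.toContinuousMap)).trans
        ((hinv g f.toContinuousMap).trans (hint f.toContinuousMap).symm)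
    conv_rhs => rw [← hmap]
    rw [Measure.map_apply (Homeomorph.smul g).continuous.measurable hs]
    rfl

end InvariantMeasure

/-! ### Consistent weights from the sign condition. -/

section Weights

variable {L : FirstOrder.Language.{u, v}} {L' : FirstOrder.Language.{u', v'}}
variable [L'.IsRelational] [Finite (Σ n, L'.Relations n)]
variable {K : Set (Bundled.{w} L.Structure)} {Kstar : Set (Bundled.{w} (L.sum L').Structure)}
variable {M : Type w} [L.Structure M]

/-- The sum of all expansions of a finite substructure. -/
noncomputable def totalExpansion (Kstar : Set (Bundled.{w} (L.sum L').Structure)) (A : FinSub L M) :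
    Omega Kstar M →₀ ℚ :=
  ∑ x : Expansions Kstar A.1, Finsupp.single (Omega.mk x) 1

theorem single_le_totalExpansion {A : FinSub L M} (x : Expansions Kstar A.1) :
    Finsupp.single (Omega.mk x) 1 ≤ totalExpansion Kstar A :=
  Finset.single_le_sum (f := fun x : Expansions Kstar A.1 => Finsupp.single (Omega.mk x) (1 : ℚ))
    (fun _ _ => Finsupp.single_nonneg.2 zero_le_one) (Finset.mem_univ x)

/-- Restriction along `π` partitions the expansions of `B`, so the difference is the sum of the
generators for all `x`. -/
theorem totalExpansion_sub_mem_V_of_embedding (hKs : IsFraisseClass Kstar) {A B : FinSub L M}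
    (π : A.1 ↪[L] B.1) : totalExpansion Kstar A - totalExpansion Kstar B ∈ V Kstar M := by
  classical
  have h : totalExpansion Kstar B = ∑ x : Expansions Kstar A.1,
      ∑ F with restrict hKs π F = x, Finsupp.single (Omega.mk F) 1 :=
    (Finset.sum_fiberwise _ _ _).symm
  rw [h, totalExpansion, ← Finset.sum_sub_distrib]
  exact Submodule.sum_mem _ fun x _ => sub_sum_restrict_mem_V hKs x π

theorem totalExpansion_sub_mem_V (hKs : IsFraisseClass Kstar) (hM : IsLimit K M)
    (A B : FinSub L M) : totalExpansion Kstar A - totalExpansion Kstar B ∈ V Kstar M := by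
  obtain ⟨C, hAC, hBC⟩ := hM.exists_finSub_le A B
  have := sub_mem
    (totalExpansion_sub_mem_V_of_embedding (Kstar := Kstar) hKs (Substructure.inclusion hAC))
    (totalExpansion_sub_mem_V_of_embedding (Kstar := Kstar) hKs (Substructure.inclusion hBC))
  rwa [sub_sub_sub_cancel_right] at this

/-- A weight is consistent if it is given by probability distributions on the expansions of the
finite substructures which are compatible with restriction along embeddings. -/
structure IsConsistentWeight (hKs : IsFraisseClass Kstar) (μ : Omega Kstar M → ℝ) : Prop where
  nonneg : ∀ x, 0 ≤ μ x
  sum_eq_one : ∀ A : FinSub L M, ∑ x : Expansions Kstar A.1, μ (Omega.mk x) = 1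
  sum_restrict : ∀ {A B : FinSub L M} (π : A.1 ↪[L] B.1) (r : Expansions Kstar A.1 → ℝ),
    ∑ y : Expansions Kstar B.1, μ (Omega.mk y) * r (restrict hKs π y) =
      ∑ x : Expansions Kstar A.1, μ (Omega.mk x) * r x

theorem IsExcellentPair.exists_consistentWeight (hK : IsExcellentPair K Kstar) (hM : IsLimit K M)
    (hV : ∀ v ∈ V Kstar M, v ≠ 0 → (∃ x, 0 < v x) ∧ (∃ y, v y < 0)) :
    ∃ μ : Omega Kstar M → ℝ, IsConsistentWeight hK.fraisse_star μ := by
  classical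
  have hKs := hK.fraisse_star
  obtain ⟨A, -⟩ := hM.exists_finSub_subset Set.finite_empty
  obtain ⟨E, hE⟩ := hK.exists_expansion (hM.finSub_mem A)
  have he0 : totalExpansion Kstar A ≠ 0 := by
    intro h
    have := single_le_totalExpansion (Kstar := Kstar) (A := A) ⟨E, hE⟩ (Omega.mk ⟨E, hE⟩)
    rw [h, Finsupp.single_eq_same] at this
    exact absurd this (by simp)
  obtain ⟨φ, hpos, hφV, hφe⟩ := exists_positive_functional (V := V Kstar M) (fun v hv h0 => by
      by_contra hne
      obtain ⟨-, y, hy⟩ := hV v hv hne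
      exact absurd (h0 y) (not_le.2 hy))
    (e := totalExpansion Kstar A)
    (Finset.sum_nonneg fun _ _ => Finsupp.single_nonneg.2 zero_le_one) he0
    -- Modulo `V` all total expansions agree, and `x` lies below the total expansion of its own
    -- substructure.
    (fun x => ⟨_, totalExpansion_sub_mem_V hKs hM A x.1, by
      have := single_le_totalExpansion x.2
      rw [add_sub_left_comm]
      exact add_le_of_nonpos_right (sub_nonpos.2 this)⟩)
  refine ⟨fun x => φ (Finsupp.single x 1), hpos, fun B => ?_, fun {B C} π r => ?_⟩
  · have h := hφV _ (totalExpansion_sub_mem_V hKs hM A B)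
    rw [map_sub, hφe, totalExpansion, map_sum] at h
    linarith
  · rw [← Finset.sum_fiberwise Finset.univ (restrict hKs π)]
    refine Finset.sum_congr rfl fun x _ => ?_
    have h := hφV _ (sub_sum_restrict_mem_V hKs x π)
    rw [map_sub, map_sum, sub_eq_zero] at h
    rw [h, Finset.sum_mul]
    refine Finset.sum_congr rfl fun y hy => ?_
    rw [(Finset.mem_filter.1 hy).2]

end Weights

/-! ### Consistent weights imply amenability. -/

section ApproximateInvariance

open Topology

variable {L : FirstOrder.Language.{u, v}} {L' : FirstOrder.Language.{u', v'}}
variable [L'.IsRelational] [Finite (Σ n, L'.Relations n)]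
variable {K : Set (Bundled.{w} L.Structure)} {Kstar : Set (Bundled.{w} (L.sum L').Structure)}
variable {M : Type w} [L.Structure M]
variable {X : Type*} [TopologicalSpace X] [CompactSpace X]

/-- Joint continuity makes the estimate local at each point, and compactness of `X` makes it
uniform. -/
theorem eventually_forall_abs_smul_sub_lt {G : Type*} [Group G] [TopologicalSpace G]
    [MulAction G X] [ContinuousSMul G X] (f : C(X, ℝ)) {ε : ℝ} (hε : 0 < ε) :
    ∀ᶠ s in 𝓝 (1 : G), ∀ p : X, |f (s • p) - f p| < ε := by
  have h := isCompact_univ (X := X) |>.eventually_forall_of_forall_eventually (x₀ := (1 : G))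
    (P := fun s p => |f (s • p) - f p| < ε) (fun p _ => by
      have hc : Continuous fun z : G × X => |f (z.1 • z.2) - f z.2| := by fun_prop
      exact hc.continuousAt.eventually_lt continuousAt_const (by simpa using hε))
  exact h.mono fun s hs p => hs p (Set.mem_univ p)

theorem exists_finset_forall_abs_sub_lt (S : Finset C(X, ℝ)) {ε : ℝ} (hε : 0 < ε) :
    ∃ t : Finset X, ∀ p, ∃ c ∈ t, ∀ f ∈ S, |f p - f c| < ε := by
  obtain ⟨t, -, ht⟩ := isCompact_univ (X := X) |>.elim_nhds_subcover
    (fun c => {p | ∀ f ∈ S, |f p - f c| < ε}) (fun c _ => by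
      refine (Filter.eventually_all_finset S).2 fun f _ => ?_
      have hc : Continuous fun p => |f p - f c| := by fun_prop
      exact hc.continuousAt.eventually_lt continuousAt_const (by simpa using hε))
  refine ⟨t, fun p => ?_⟩
  obtain ⟨c, hc, hp⟩ := Set.mem_iUnion₂.1 (ht (Set.mem_univ p))
  exact ⟨c, hc, hp⟩

/-- If `q` nearly depends only on the restriction along `π`, consistency identifies its average up
to `ε` with one that involves neither `D` nor `π`. Different embeddings of `A` into `D` thus give
nearly the same average. -/
theorem IsConsistentWeight.abs_sum_sub_le {hKs : IsFraisseClass Kstar} {μ : Omega Kstar M → ℝ}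
    (hμ : IsConsistentWeight hKs μ) {A D : FinSub L M} (π : A.1 ↪[L] D.1)
    {q : Expansions Kstar D.1 → ℝ} {r : Expansions Kstar A.1 → ℝ} {ε : ℝ}
    (h : ∀ y, |q y - r (restrict hKs π y)| ≤ ε) :
    |∑ y, μ (Omega.mk y) * q y - ∑ x, μ (Omega.mk x) * r x| ≤ ε := by
  rw [← hμ.sum_restrict π, ← Finset.sum_sub_distrib]
  refine (Finset.abs_sum_le_sum_abs _ _).trans ?_
  calc ∑ y, |μ (Omega.mk y) * q y - μ (Omega.mk y) * r (restrict hKs π y)|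
      ≤ ∑ y, μ (Omega.mk y) * ε := Finset.sum_le_sum fun y _ => by
        rw [← mul_sub, abs_mul, abs_of_nonneg (hμ.nonneg _)]
        exact mul_le_mul_of_nonneg_left (h y) (hμ.nonneg _)
    _ = ε := by rw [← Finset.sum_mul, hμ.sum_eq_one, one_mul]

/-- A consistent weight yields approximately invariant states on each flow. -/
theorem IsConsistentWeight.exists_approximately_invariant (hK : IsExcellentPair K Kstar)
    (hM : IsLimit K M) {μ : Omega Kstar M → ℝ} (hμ : IsConsistentWeight hK.fraisse_star μ)
    [Nonempty X] [MulAction (Aut L M) X] [ContinuousSMul (Aut L M) X]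
    (S : Finset C(X, ℝ)) (T : Finset (Aut L M)) {ε : ℝ} (hε : 0 < ε) :
    ∃ ν : C(X, ℝ) →ₗ[ℝ] ℝ, (∀ f, 0 ≤ f → 0 ≤ ν f) ∧ ν 1 = 1 ∧
      ∀ f ∈ S, ∀ g ∈ T, |ν (translate g f) - ν f| ≤ ε := by
  have hδ : 0 < ε / 4 := by positivity
  obtain ⟨A, hA⟩ := hM.exists_stabilizer_subset
    ((Filter.eventually_all_finset S).2 fun f _ =>
      eventually_forall_abs_smul_sub_lt (G := Aut L M) f hδ)
  obtain ⟨t, ht⟩ := exists_finset_forall_abs_sub_lt S hδ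
  have hAfin : Finite A.1 := A.2.1
  -- `D` contains `A` and every `g⁻¹ A` with `g ∈ T`, so that `1` and each `g⁻¹` restrict to
  -- embeddings of `A` into `D`.
  obtain ⟨D, hD⟩ := hM.exists_finSub_subset (s := (A.1 : Set M) ∪
    ⋃ g ∈ T, (fun a => g⁻¹.toFun a) '' (A.1 : Set M))
    ((Set.toFinite (A.1 : Set M)).union
      (T.finite_toSet.biUnion fun g _ => (Set.toFinite (A.1 : Set M)).image _))
  obtain ⟨p₀⟩ := ‹Nonempty X›
  choose k hk using fun e : A.1 ↪[L] M => hM.exists_aut e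
  choose cen hcent hcen using ht
  -- The colour of an embedding is a centre near `k⁻¹ • p₀`, where `k` is a chosen automorphism
  -- extending it. Another extension differs by an element fixing `A`, which changes each `f ∈ S` by
  -- less than `ε / 4`.
  obtain ⟨c, e, hce⟩ := hK.exists_homogeneous_embeddings hM A D
    fun e => (⟨cen ((k e)⁻¹ • p₀), hcent _⟩ : t)
  choose k' hk' using fun y => hM.exists_aut (e y)
  have hclose : ∀ g : Aut L M, ∀ h : (∀ a ∈ A.1, g⁻¹.toFun a ∈ D.1), ∀ f ∈ S, ∀ y,
      |f (g • (k' y)⁻¹ • p₀) - f (c (restrict hK.fraisse_star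
        (g⁻¹.restrictEmbedding A D h) y))| ≤ ε / 2 := by
    intro g h f hf y
    rw [← hce]
    set i := g⁻¹.restrictEmbedding A D h
    set e' := (e y).comp i
    -- On `A`, `k' y * g⁻¹` agrees with `e'`, hence with `k e'`; the quotient therefore fixes `A`
    -- pointwise.
    have hs := hA ((k' y * g⁻¹)⁻¹ * k e') (fun a ha => by
      have h1 : (k e').toFun a = (k' y * g⁻¹).toFun a := by
        rw [hk e' ⟨a, ha⟩, Aut.mul_toFun]
        exact (hk' y (i ⟨a, ha⟩)).symm
      rw [Aut.mul_toFun, h1, Aut.inv_toFun_toFun]) f hf ((k e')⁻¹ • p₀)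
    have heq : ((k' y * g⁻¹)⁻¹ * k e') • (k e')⁻¹ • p₀ = g • (k' y)⁻¹ • p₀ := by
      rw [smul_smul, smul_smul, mul_inv_cancel_right, mul_inv_rev, inv_inv]
    rw [heq] at hs
    have hs' := hcen ((k e')⁻¹ • p₀) f hf
    have := abs_sub_le (f (g • (k' y)⁻¹ • p₀)) (f ((k e')⁻¹ • p₀)) (f (cen ((k e')⁻¹ • p₀)))
    linarith
  let ν : C(X, ℝ) →ₗ[ℝ] ℝ :=
    { toFun := fun f => ∑ y : Expansions Kstar D.1, μ (Omega.mk y) * f ((k' y)⁻¹ • p₀)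
      map_add' := fun f g => by
        simp only [ContinuousMap.add_apply, mul_add, Finset.sum_add_distrib]
      map_smul' := fun r f => by
        simp only [ContinuousMap.smul_apply, smul_eq_mul, RingHom.id_apply, Finset.mul_sum]
        exact Finset.sum_congr rfl fun _ _ => mul_left_comm _ _ _ }
  refine ⟨ν, fun f hf => Finset.sum_nonneg fun y _ => mul_nonneg (hμ.nonneg _) (hf _), ?_,
    fun f hf g hg => ?_⟩
  · refine Eq.trans (Finset.sum_congr rfl fun y _ => ?_) (hμ.sum_eq_one D)
    rw [ContinuousMap.one_apply, mul_one]
  · have h₁ := hμ.abs_sum_sub_le ((1 : Aut L M)⁻¹.restrictEmbedding A D fun a ha => by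
      rw [inv_one, Aut.one_toFun]
      exact hD (Or.inl ha)) (r := fun x => f (c x)) (hclose 1 _ f hf)
    have h₂ := hμ.abs_sum_sub_le (g⁻¹.restrictEmbedding A D fun a ha =>
      hD (Or.inr (Set.mem_iUnion₂.2 ⟨g, hg, a, ha, rfl⟩)))
      (r := fun x => f (c x)) (hclose g _ f hf)
    simp only [one_smul] at h₁
    have := abs_sub_le (ν (translate g f)) (∑ x, μ (Omega.mk x) * f (c x)) (ν f)
    rw [abs_sub_comm (∑ x, μ (Omega.mk x) * f (c x)) (ν f)] at this
    have h₁' : |ν f - ∑ x, μ (Omega.mk x) * f (c x)| ≤ ε / 2 := h₁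
    have h₂' : |ν (translate g f) - ∑ x, μ (Omega.mk x) * f (c x)| ≤ ε / 2 := h₂
    linarith

theorem IsConsistentWeight.isAmenable (hK : IsExcellentPair K Kstar)
    (hM : IsLimit K M) {μ : Omega Kstar M → ℝ} (hμ : IsConsistentWeight hK.fraisse_star μ) :
    IsAmenable (Aut L M) := by
  intro X _ _ _ _ _ _ _ _
  obtain ⟨Λ, hpos, hone, hinv⟩ := exists_invariant_state (G := Aut L M) (X := X)
    fun S T ε hε => hμ.exists_approximately_invariant hK hM S T hε
  exact exists_invariant_measure hpos hone hinv

end ApproximateInvariance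

/-! ### The flow of expansions and the converse direction. -/

section Flow

open Topology

/-- The index set of the truth values which determine a relational structure on `A`. -/
abbrev Atoms (L' : FirstOrder.Language.{u', v'}) [Finite (Σ n, L'.Relations n)] (A : Type w) :
    Type w :=
  Shrink.{w} (Σ R : (Σ n, L'.Relations n), (Fin R.1 → A))

variable {L : FirstOrder.Language.{u, v}} {L' : FirstOrder.Language.{u', v'}}
variable [Finite (Σ n, L'.Relations n)]

/-- The atom `R(a)`. -/
noncomputable def Atoms.mk {A : Type w} {n : ℕ} (R : L'.Relations n) (a : Fin n → A) :
    Atoms L' A :=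
  equivShrink _ ⟨⟨n, R⟩, a⟩

/-- The pullback of truth values along a map. -/
noncomputable def comapAtoms {A B : Type w} (f : A → B) (b : Atoms L' B → Bool) :
    Atoms L' A → Bool :=
  fun t => b (Atoms.mk ((equivShrink _).symm t).1.2 (f ∘ ((equivShrink _).symm t).2))

theorem comapAtoms_mk {A B : Type w} (f : A → B) (b : Atoms L' B → Bool) {n : ℕ}
    (R : L'.Relations n) (a : Fin n → A) :
    comapAtoms f b (Atoms.mk R a) = b (Atoms.mk R (f ∘ a)) := by
  have h : (equivShrink _).symm (Atoms.mk R a) =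
      (⟨⟨n, R⟩, a⟩ : Σ R : (Σ n, L'.Relations n), (Fin R.1 → A)) :=
    Equiv.symm_apply_apply _ _
  change b (Atoms.mk _ _) = _
  rw [h]

variable [L'.IsRelational]

/-- The structure in which the atoms have the given truth values. -/
@[reducible] noncomputable def codedStructure {A : Type w} (b : Atoms L' A → Bool) :
    L'.Structure A where
  funMap c _ := isEmptyElim c
  RelMap R a := b (Atoms.mk R a) = true

open Classical in
theorem codedStructure_surjective (A : Type w) :
    Function.Surjective (codedStructure : (Atoms L' A → Bool) → L'.Structure A) := by
  intro E
  refine ⟨fun t => decide (E.RelMap ((equivShrink _).symm t).1.2 ((equivShrink _).symm t).2),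
    structure_ext_of_isRelational fun n R a => ?_⟩
  have h : (equivShrink _).symm (Atoms.mk R a) =
      (⟨⟨n, R⟩, a⟩ : Σ R : (Σ n, L'.Relations n), (Fin R.1 → A)) :=
    Equiv.symm_apply_apply _ _
  change decide (E.RelMap _ _) = true ↔ _
  rw [h, decide_eq_true_iff]

theorem codedStructure_comapAtoms {A B : Type w} (f : A → B) (b : Atoms L' B → Bool) :
    codedStructure (comapAtoms f b) = comapStructure f (codedStructure b) := by
  refine structure_ext_of_isRelational fun n R a => ?_
  change comapAtoms f b (Atoms.mk R a) = true ↔ b (Atoms.mk R (f ∘ a)) = true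
  rw [comapAtoms_mk]

theorem isOpen_comapStructure_eq {A B : Type w} [Finite A] (f : A → B) (E : L'.Structure A) :
    IsOpen {b : Atoms L' B → Bool | comapStructure f (codedStructure b) = E} := by
  have h : {b : Atoms L' B → Bool | comapStructure f (codedStructure b) = E} =
      ⋂ R : (Σ n, L'.Relations n), ⋂ a : Fin R.1 → A,
        {b | b (Atoms.mk R.2 (f ∘ a)) = true ↔ E.RelMap R.2 a} := by
    ext b
    simp only [Set.mem_iInter]
    constructor
    · rintro rfl R a
      exact Iff.rfl
    · exact fun h => structure_ext_of_isRelational fun n R a => h ⟨n, R⟩ a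
  rw [h]
  refine isOpen_iInter_of_finite fun R => isOpen_iInter_of_finite fun a => ?_
  exact (isOpen_discrete {c : Bool | c = true ↔ E.RelMap R.2 a}).preimage
    (continuous_apply (A := fun _ : Atoms L' B => Bool) (Atoms.mk R.2 (f ∘ a)))

theorem isClopen_comapStructure_mem {A B : Type w} [Finite A] (f : A → B)
    (P : Set (L'.Structure A)) :
    IsClopen {b : Atoms L' B → Bool | comapStructure f (codedStructure b) ∈ P} := by
  have h : ∀ P : Set (L'.Structure A),
      IsOpen {b : Atoms L' B → Bool | comapStructure f (codedStructure b) ∈ P} := by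
    intro P
    have : {b : Atoms L' B → Bool | comapStructure f (codedStructure b) ∈ P} =
        ⋃ E ∈ P, {b | comapStructure f (codedStructure b) = E} := by
      ext b
      simp
    rw [this]
    exact isOpen_biUnion fun E _ => isOpen_comapStructure_eq f E
  exact ⟨⟨h Pᶜ⟩, h P⟩

variable {K : Set (Bundled.{w} L.Structure)} {Kstar : Set (Bundled.{w} (L.sum L').Structure)}
variable {M : Type w} [L.Structure M]

/-- The space of expansions of `M` all of whose finite substructures are in `Kstar`. -/
def ExpansionFlow (Kstar : Set (Bundled.{w} (L.sum L').Structure)) (M : Type w) [L.Structure M] :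
    Type w :=
  {b : Atoms L' M → Bool // ∀ A : FinSub L M,
    comapStructure (Subtype.val : A.1 → M) (codedStructure b) ∈ Expansions (L := L) Kstar A.1}

namespace ExpansionFlow

instance : TopologicalSpace (ExpansionFlow Kstar M) := instTopologicalSpaceSubtype

instance : T2Space (ExpansionFlow Kstar M) := inferInstanceAs (T2Space (Subtype _))

instance : CompactSpace (ExpansionFlow Kstar M) := by
  let Z : Set (Atoms L' M → Bool) := {b | ∀ A : FinSub L M,
    comapStructure (Subtype.val : A.1 → M) (codedStructure b) ∈ Expansions (L := L) Kstar A.1}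
  have h : Z = ⋂ A : FinSub L M, {b | comapStructure (Subtype.val : A.1 → M) (codedStructure b) ∈
      Expansions (L := L) Kstar A.1} :=
    Set.ext fun b => ⟨fun h => Set.mem_iInter.2 h, fun h => Set.mem_iInter.1 h⟩
  have hZ : IsClosed Z := by
    rw [h]
    exact isClosed_iInter fun A =>
      have := A.2.1
      (isClopen_comapStructure_mem _ _).1
  exact isCompact_iff_compactSpace.1 hZ.isCompact

/-- The restriction of an expansion of `M` to a finite substructure. -/
noncomputable def restrict (b : ExpansionFlow Kstar M) (A : FinSub L M) : Expansions Kstar A.1 :=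
  ⟨comapStructure (Subtype.val : A.1 → M) (codedStructure b.1), b.2 A⟩

theorem isClopen_restrict_eq {A : FinSub L M} (x : Expansions Kstar A.1) :
    IsClopen {b : ExpansionFlow Kstar M | b.restrict A = x} := by
  have := A.2.1
  have h : {b : ExpansionFlow Kstar M | b.restrict A = x} =
      Subtype.val ⁻¹' {b | comapStructure (Subtype.val : A.1 → M) (codedStructure b) ∈
        ({x.1} : Set (L'.Structure A.1))} :=
    Set.ext fun b => Subtype.ext_iff
  rw [h]
  exact (isClopen_comapStructure_mem _ _).preimage continuous_subtype_val

/-- By compactness it suffices to satisfy the constraint at one finite substructure at a time: the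
constraints are closed, and heredity makes them directed. -/
theorem nonempty (hK : IsExcellentPair K Kstar) (hM : IsLimit K M) :
    Nonempty (ExpansionFlow Kstar M) := by
  let Z : FinSub L M → Set (Atoms L' M → Bool) := fun A =>
    {b | comapStructure (Subtype.val : A.1 → M) (codedStructure b) ∈ Expansions (L := L) Kstar A.1}
  have hclosed : ∀ A, IsClosed (Z A) := fun A => by
    have := A.2.1
    exact (isClopen_comapStructure_mem _ _).1
  have hne : ∀ A, (Z A).Nonempty := by
    intro A
    obtain ⟨E, hE⟩ := hK.exists_expansion (hM.finSub_mem A)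
    -- No relation holds outside tuples from `A`; only the restriction to `A` matters here.
    let E' : L'.Structure M :=
      { funMap := fun c _ => isEmptyElim c
        RelMap := fun R a => ∃ a' : _ → A.1, Subtype.val ∘ a' = a ∧ E.RelMap R a' }
    obtain ⟨b, hb⟩ := codedStructure_surjective M E'
    refine ⟨b, ?_⟩
    have : comapStructure (Subtype.val : A.1 → M) (codedStructure b) = E := by
      rw [hb]
      refine structure_ext_of_isRelational fun n R a => ⟨?_, fun h => ⟨a, rfl, h⟩⟩
      rintro ⟨a', ha', h⟩
      rwa [← Subtype.val_injective.comp_left ha']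
    change comapStructure (Subtype.val : A.1 → M) (codedStructure b) ∈
      Expansions (L := L) Kstar A.1
    rw [this]
    exact hE
  have hmono : ∀ A B : FinSub L M, A.1 ≤ B.1 → Z B ⊆ Z A := by
    intro A B hAB b hb
    have := A.2.2
    exact comapStructure_mem_expansions hK.fraisse_star (Substructure.inclusion hAB) hb
  have hdir : Directed (· ⊇ ·) Z := by
    intro A B
    obtain ⟨C, hAC, hBC⟩ := hM.exists_finSub_le A B
    exact ⟨C, hmono A C hAC, hmono B C hBC⟩
  obtain ⟨A₀, -⟩ := hM.exists_finSub_subset Set.finite_empty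
  have : Nonempty (FinSub L M) := ⟨A₀⟩
  obtain ⟨b, hb⟩ := IsCompact.nonempty_iInter_of_directed_nonempty_isCompact_isClosed Z hdir hne
    (fun A => (hclosed A).isCompact) hclosed
  exact ⟨⟨b, Set.mem_iInter.1 hb⟩⟩

/-- The action of the automorphism group on the expansions. -/
@[reducible] noncomputable def mulAction (hKs : IsFraisseClass Kstar) :
    MulAction (Aut L M) (ExpansionFlow Kstar M) where
  smul g b := ⟨comapAtoms g⁻¹.toFun b.1, fun A => by
    have := A.2.1
    have := A.2.2
    let B : FinSub L M :=
      ⟨A.1.map (show M ≃[L] M from (g⁻¹ : Aut L M)).toHom,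
        ((Set.toFinite (A.1 : Set M)).image _).to_subtype,
        ⟨_, Set.mem_image_of_mem _ (Classical.arbitrary A.1).2⟩⟩
    rw [codedStructure_comapAtoms]
    exact comapStructure_mem_expansions hKs
      (g⁻¹.restrictEmbedding A B fun a ha => Set.mem_image_of_mem g⁻¹.toFun ha) (b.2 B)⟩
  one_smul b := Subtype.ext (by
    funext t
    obtain ⟨⟨⟨n, R⟩, a⟩, rfl⟩ := (equivShrink _).surjective t
    refine (comapAtoms_mk _ _ R a).trans ?_
    rw [inv_one]
    rfl)
  mul_smul g h b := Subtype.ext (by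
    funext t
    obtain ⟨⟨⟨n, R⟩, a⟩, rfl⟩ := (equivShrink _).surjective t
    refine (comapAtoms_mk _ _ R a).trans ?_
    refine Eq.trans ?_ ((comapAtoms_mk _ (comapAtoms _ _) R a).trans (comapAtoms_mk _ _ R _)).symm
    rw [mul_inv_rev]
    rfl)

theorem isOpen_toFun_eq (c a : M) : IsOpen {g : Aut L M | g.toFun c = a} :=
  (iInf_le (fun a : M => TopologicalSpace.induced (fun g : Aut L M => g.toFun a) ⊥) c) _
    ⟨{a}, trivial, rfl⟩

/-- A coordinate of `g • b` reads `b` at an atom determined by finitely many values of `g⁻¹`, and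
these are locally constant in `g`. -/
theorem continuousSMul (hKs : IsFraisseClass Kstar) :
    let _ : MulAction (Aut L M) (ExpansionFlow Kstar M) := mulAction hKs
    ContinuousSMul (Aut L M) (ExpansionFlow Kstar M) := by
  let _ : MulAction (Aut L M) (ExpansionFlow Kstar M) := mulAction hKs
  refine ⟨Continuous.subtype_mk (continuous_pi fun t => ?_) _⟩
  obtain ⟨⟨⟨n, R⟩, a⟩, rfl⟩ := (equivShrink _).surjective t
  have heval : ∀ z : Aut L M × ExpansionFlow Kstar M,
      comapAtoms z.1⁻¹.toFun z.2.1 (equivShrink _ ⟨⟨n, R⟩, a⟩) =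
        z.2.1 (Atoms.mk R (z.1⁻¹.toFun ∘ a)) := fun z => comapAtoms_mk _ _ R a
  refine continuous_iff_continuousAt.2 fun ⟨g₀, b₀⟩ => ?_
  have hc : Continuous fun z : Aut L M × ExpansionFlow Kstar M =>
      z.2.1 (Atoms.mk R (g₀⁻¹.toFun ∘ a)) :=
    (continuous_apply _).comp (continuous_subtype_val.comp continuous_snd)
  refine hc.continuousAt.congr ?_
  have hg : ∀ᶠ g in 𝓝 g₀, ∀ i : Fin n, g.toFun (g₀⁻¹.toFun (a i)) = a i :=
    Filter.eventually_all.2 fun i =>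
      (isOpen_toFun_eq _ _).mem_nhds (Aut.toFun_inv_toFun g₀ (a i))
  filter_upwards [hg.prod_inl_nhds b₀] with z hz
  refine Eq.trans ?_ (heval z).symm
  have ha : g₀⁻¹.toFun ∘ a = z.1⁻¹.toFun ∘ a := funext fun i => by
    change g₀⁻¹.toFun (a i) = z.1⁻¹.toFun (a i)
    conv_rhs => rw [← hz i, Aut.inv_toFun_toFun]
  rw [ha]

theorem codedStructure_smul (hKs : IsFraisseClass Kstar) (g : Aut L M)
    (b : ExpansionFlow Kstar M) :
    let _ : MulAction (Aut L M) (ExpansionFlow Kstar M) := mulAction hKs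
    codedStructure (g⁻¹ • b).1 = comapStructure g.toFun (codedStructure b.1) := by
  refine (codedStructure_comapAtoms _ _).trans ?_
  rw [inv_inv]

theorem restrict_smul (hKs : IsFraisseClass Kstar) {A B : FinSub L M} (π : A.1 ↪[L] B.1)
    (g : Aut L M) (hg : ∀ a : A.1, g.toFun a = π a) (b : ExpansionFlow Kstar M) :
    let _ : MulAction (Aut L M) (ExpansionFlow Kstar M) := mulAction hKs
    (g⁻¹ • b).restrict A = CompanionClass.restrict hKs π (b.restrict B) := by
  let _ : MulAction (Aut L M) (ExpansionFlow Kstar M) := mulAction hKs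
  refine Subtype.ext ?_
  change comapStructure Subtype.val (codedStructure (g⁻¹ • b).1) = _
  rw [codedStructure_smul hKs g b]
  refine structure_ext_of_isRelational fun n R a => ?_
  have : g.toFun ∘ Subtype.val ∘ a = Subtype.val ∘ π ∘ a := funext fun i => hg (a i)
  change (codedStructure b.1).RelMap R (g.toFun ∘ Subtype.val ∘ a) ↔
    (codedStructure b.1).RelMap R (Subtype.val ∘ π ∘ a)
  rw [this]

variable [MeasurableSpace (ExpansionFlow Kstar M)] [BorelSpace (ExpansionFlow Kstar M)]

/-- Ultrahomogeneity extends `π` to an automorphism `g`. The event on the left is the preimage under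
`g⁻¹` of the event on the right. -/
theorem measureReal_restrict_embedding (hKs : IsFraisseClass Kstar) (hM : IsLimit K M)
    {μ : Measure (ExpansionFlow Kstar M)}
    (hμ : letI : MulAction (Aut L M) (ExpansionFlow Kstar M) := mulAction hKs
      SMulInvariantMeasure (Aut L M) (ExpansionFlow Kstar M) μ)
    {A B : FinSub L M} (π : A.1 ↪[L] B.1) (x : Expansions Kstar A.1) :
    μ.real {b | CompanionClass.restrict hKs π (b.restrict B) = x} =
      μ.real {b | b.restrict A = x} := by
  let _ : MulAction (Aut L M) (ExpansionFlow Kstar M) := mulAction hKs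
  obtain ⟨g, hg⟩ := hM.exists_aut (B.1.subtype.comp π)
  have h := hμ.measure_preimage_smul g⁻¹ (isClopen_restrict_eq x).isOpen.measurableSet
  have hpre : (fun b : ExpansionFlow Kstar M => g⁻¹ • b) ⁻¹' {b | b.restrict A = x} =
      {b | CompanionClass.restrict hKs π (b.restrict B) = x} :=
    Set.ext fun b => by
      change (g⁻¹ • b).restrict A = x ↔ _
      rw [restrict_smul hKs π g hg b]
      rfl
  rw [hpre] at h
  exact congrArg ENNReal.toReal h

open Classical in
theorem measureReal_restrict_eq_sum (hKs : IsFraisseClass Kstar) (hM : IsLimit K M)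
    {μ : Measure (ExpansionFlow Kstar M)} [IsProbabilityMeasure μ]
    (hμ : letI : MulAction (Aut L M) (ExpansionFlow Kstar M) := mulAction hKs
      SMulInvariantMeasure (Aut L M) (ExpansionFlow Kstar M) μ)
    {A B : FinSub L M} (π : A.1 ↪[L] B.1) (x : Expansions Kstar A.1) :
    μ.real {b | b.restrict A = x} =
      ∑ F with CompanionClass.restrict hKs π F = x, μ.real {b | b.restrict B = F} := by
  rw [← measureReal_restrict_embedding hKs hM hμ π x, ← measureReal_biUnion_finset]
  · congr 1
    refine Set.ext fun b => ⟨fun h => ?_, fun h => ?_⟩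
    · exact Set.mem_iUnion₂.2 ⟨b.restrict B, Finset.mem_filter.2 ⟨Finset.mem_univ _, h⟩, rfl⟩
    · obtain ⟨F, hF, rfl⟩ := Set.mem_iUnion₂.1 h
      exact (Finset.mem_filter.1 hF).2
  · intro F _ G _ hFG
    refine Set.disjoint_left.2 fun b hF hG => hFG ?_
    exact (show b.restrict B = F from hF).symm.trans hG
  · exact fun F _ => (isClopen_restrict_eq F).isOpen.measurableSet

/-- Choose `B` such that `x` embeds in each of its expansions. The events that a given `π` carries
`x` into the restriction to `B` are finitely many, cover the flow and all have the measure of the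
cylinder of `x`, which therefore cannot be zero. -/
theorem measureReal_restrict_pos (hK : IsExcellentPair K Kstar) (hM : IsLimit K M)
    {μ : Measure (ExpansionFlow Kstar M)} [IsProbabilityMeasure μ]
    (hμ : letI : MulAction (Aut L M) (ExpansionFlow Kstar M) := mulAction hK.fraisse_star
      SMulInvariantMeasure (Aut L M) (ExpansionFlow Kstar M) μ)
    {A : FinSub L M} (x : Expansions Kstar A.1) :
    0 < μ.real {b | b.restrict A = x} := by
  refine lt_of_le_of_ne measureReal_nonneg fun h0 => ?_
  obtain ⟨B, hB⟩ := hK.exists_embedding_restrict_eq hM x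
  have := A.2.1
  have := B.2.1
  have : Finite (A.1 ↪[L] B.1) := DFunLike.finite _
  have hcover : (Set.univ : Set (ExpansionFlow Kstar M)) ⊆
      ⋃ π : A.1 ↪[L] B.1, {b | CompanionClass.restrict hK.fraisse_star π (b.restrict B) = x} :=
    fun b _ => Set.mem_iUnion.2 (hB (b.restrict B))
  have hnull : μ Set.univ = 0 := by
    refine measure_mono_null hcover (measure_iUnion_null fun π => ?_)
    rw [← measureReal_eq_zero_iff, measureReal_restrict_embedding hK.fraisse_star hM hμ π x, ← h0]
  exact one_ne_zero (measure_univ.symm.trans hnull)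

end ExpansionFlow

theorem exists_pos_of_linearCombination_eq_zero {Ω : Type*} {w : Ω → ℝ} (hw : ∀ x, 0 < w x)
    {v : Ω →₀ ℚ} (hv : v ≠ 0) (h : Finsupp.linearCombination ℚ w v = 0) : ∃ x, 0 < v x := by
  by_contra! hle
  apply hv
  ext x
  by_contra hx
  rw [Finsupp.linearCombination_apply, Finsupp.sum] at h
  have hterm : ∀ x ∈ v.support, v x • w x ≤ 0 := fun x _ => by
    rw [Rat.smul_def]
    exact mul_nonpos_of_nonpos_of_nonneg (by exact_mod_cast hle x) (hw x).le
  have := (Finset.sum_eq_zero_iff_of_nonpos hterm).1 h x (Finsupp.mem_support_iff.2 hx)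
  rw [Rat.smul_def, mul_eq_zero, Rat.cast_eq_zero] at this
  exact this.elim hx (hw x).ne'

theorem IsExcellentPair.exists_pos_neg_of_isAmenable (hK : IsExcellentPair K Kstar)
    (hM : IsLimit K M) (hG : IsAmenable (Aut L M)) {v : Omega Kstar M →₀ ℚ}
    (hv : v ∈ V Kstar M) (hv0 : v ≠ 0) : (∃ x, 0 < v x) ∧ (∃ y, v y < 0) := by
  classical
  have hKs := hK.fraisse_star
  let _ : MulAction (Aut L M) (ExpansionFlow Kstar M) := ExpansionFlow.mulAction hKs
  have := ExpansionFlow.continuousSMul (M := M) hKs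
  have := ExpansionFlow.nonempty hK hM
  let _ : MeasurableSpace (ExpansionFlow Kstar M) := borel _
  have : BorelSpace (ExpansionFlow Kstar M) := ⟨rfl⟩
  -- `IsAmenable` quantifies over spaces in universe `w`; the `Shrink` in `Atoms` places the flow
  -- there.
  obtain ⟨μ, hprob, hinv⟩ := hG (ExpansionFlow Kstar M)
  let w : Omega Kstar M → ℝ := fun x => μ.real {b | b.restrict x.1 = x.2}
  have hw : ∀ x, 0 < w x := fun x => ExpansionFlow.measureReal_restrict_pos hK hM hinv x.2
  have hsingle : ∀ x, Finsupp.linearCombination ℚ w (Finsupp.single x 1) = w x := fun x => by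
    rw [Finsupp.linearCombination_single, one_smul]
  have hker : V Kstar M ≤ LinearMap.ker (Finsupp.linearCombination ℚ w) := by
    refine Submodule.span_le.2 ?_
    rintro _ ⟨A, B, x, π, rfl⟩
    rw [SetLike.mem_coe, LinearMap.mem_ker, finsum_extensions hKs, map_sub, map_sum, sub_eq_zero]
    exact (hsingle _).trans ((ExpansionFlow.measureReal_restrict_eq_sum hKs hM hinv π x).trans
      (Finset.sum_congr rfl fun F _ => (hsingle (Omega.mk F)).symm))
  refine ⟨exists_pos_of_linearCombination_eq_zero hw hv0 (hker hv), ?_⟩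
  obtain ⟨y, hy⟩ := exists_pos_of_linearCombination_eq_zero hw (neg_ne_zero.2 hv0)
    (hker (neg_mem hv))
  exact ⟨y, neg_pos.1 hy⟩

end Flow

end CompanionClass

theorem theorem3p1 {L : FirstOrder.Language.{u, v}} [Countable L.Symbols]
    {L' : FirstOrder.Language.{u', v'}} [L'.IsRelational] [Finite (Σ n, L'.Relations n)]
    (K : Set (Bundled.{w} L.Structure)) (Kstar : Set (Bundled.{w} (L.sum L').Structure))
    (hK : CompanionClass.IsExcellentPair K Kstar)
    (M : Type w) [L.Structure M] (hM : CompanionClass.IsLimit K M) :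
    CompanionClass.IsAmenable (CompanionClass.Aut L M) ↔
      ∀ v ∈ CompanionClass.V Kstar M, v ≠ 0 → (∃ x, 0 < v x) ∧ (∃ y, v y < 0) := by
  constructor
  · exact fun hG v hv hv0 => hK.exists_pos_neg_of_isAmenable hM hG hv hv0
  · intro hV
    obtain ⟨μ, hμ⟩ := hK.exists_consistentWeight hM hV
    exact hμ.isAmenable hK hM
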